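/- Let $\mathfrak g_{5,37}$ be the real Lie algebra with basis $e_1,\dots,e_5$ and the nonzero brackets $$[e_1,e_4]=2e_1,\quad [e_2,e_3]=e_1,\quad [e_2,e_4]=e_2,\quad [e_2,e_5]=-e_3,\quad [e_3,e_4]=e_3,\quad [e_3,e_5]=e_2$$ (up to antisymmetry). A holomorphic realization of $\mathfrak g_{5,37}$ on an open set $U\subset\mathbb C^3$ (coordinates $z_1,z_2,w=u+iv$) is a faithful representation of $\mathfrak g_{5,37}$, as a real Lie algebra, by holomorphic vector fields $X=f\,\partial/\partial z_1+g\,\partial/\partial z_2+h\,\partial/\partial w$ on $U$. A $5$-dimensional orbit of it is a connected real-analytic real hypersurface $M\subset U$ (embedded, not necessarily closed) such that at every $p\in M$ the values at $p$ of the real vector fields $2\,\mathrm{Re}\,X$, for $X$ in the realization, form exactly the tangent space $T_pM$. Then every $5$-dimensional orbit $M$ of every holomorphic realization of $\mathfrak g_{5,37}$ whose Levi form is nondegenerate at each point is spherical: for one of the two quadrics $$Q_\pm=\{\,v=|z_1|^2\pm|z_2|^2\,\},$$ every point $p\in M$ has an open neighbourhood $V\subset\mathbb C^3$ and a biholomorphic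 map $F$ of $V$ onto an open set $W\subset\mathbb C^3$ with $F(M\cap V)=Q\cap W$, where $Q$ is that quadric. -/

import Mathlib

open Topology

noncomputable section

/-- The five-dimensional real Lie algebra `𝔤_{5,37}`; the vector `x` stands for
`x 0 • e₁ + x 1 • e₂ + x 2 • e₃ + x 3 • e₄ + x 4 • e₅`. -/
def G537 : Type := Fin 5 → ℝ

namespace G537

instance : AddCommGroup G537 := inferInstanceAs (AddCommGroup (Fin 5 → ℝ))

instance : Module ℝ G537 := inferInstanceAs (Module ℝ (Fin 5 → ℝ))

/-- The bilinear extension of the relations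
`[e₁,e₄] = 2e₁`, `[e₂,e₃] = e₁`, `[e₂,e₄] = e₂`, `[e₂,e₅] = -e₃`, `[e₃,e₄] = e₃`,
`[e₃,e₅] = e₂`; the other brackets `[e_i,e_j]`, `i < j`, are zero. -/
instance : Bracket G537 G537 where
  bracket x y :=
    ![2 * (x 0 * y 3 - x 3 * y 0) + (x 1 * y 2 - x 2 * y 1),
      (x 1 * y 3 - x 3 * y 1) + (x 2 * y 4 - x 4 * y 2),
      (x 2 * y 3 - x 3 * y 2) - (x 1 * y 4 - x 4 * y 1),
      0,
      0]

theorem ext_coords {x y : G537} (h0 : x 0 = y 0) (h1 : x 1 = y 1) (h2 : x 2 = y 2)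
    (h3 : x 3 = y 3) (h4 : x 4 = y 4) : x = y := by
  funext i
  fin_cases i
  exacts [h0, h1, h2, h3, h4]

theorem add_apply (x y : G537) (i : Fin 5) : (x + y) i = x i + y i := rfl

theorem smul_apply (t : ℝ) (x : G537) (i : Fin 5) : (t • x) i = t * x i := rfl

theorem zero_apply (i : Fin 5) : (0 : G537) i = 0 := rfl

theorem lie_apply_zero (x y : G537) :
    ⁅x, y⁆ 0 = 2 * (x 0 * y 3 - x 3 * y 0) + (x 1 * y 2 - x 2 * y 1) := rfl

theorem lie_apply_one (x y : G537) :
    ⁅x, y⁆ 1 = (x 1 * y 3 - x 3 * y 1) + (x 2 * y 4 - x 4 * y 2) := rfl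

theorem lie_apply_two (x y : G537) :
    ⁅x, y⁆ 2 = (x 2 * y 3 - x 3 * y 2) - (x 1 * y 4 - x 4 * y 1) := rfl

theorem lie_apply_three (x y : G537) : ⁅x, y⁆ 3 = 0 := rfl

theorem lie_apply_four (x y : G537) : ⁅x, y⁆ 4 = 0 := rfl

instance : LieRing G537 where
  add_lie x y z := by
    apply ext_coords <;> simp only [add_apply, lie_apply_zero, lie_apply_one, lie_apply_two,
      lie_apply_three, lie_apply_four] <;> ring
  lie_add x y z := by
    apply ext_coords <;> simp only [add_apply, lie_apply_zero, lie_apply_one, lie_apply_two,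
      lie_apply_three, lie_apply_four] <;> ring
  lie_self x := by
    apply ext_coords <;> simp only [zero_apply, lie_apply_zero, lie_apply_one, lie_apply_two,
      lie_apply_three, lie_apply_four] <;> ring
  leibniz_lie x y z := by
    apply ext_coords <;> simp only [add_apply, lie_apply_zero, lie_apply_one, lie_apply_two,
      lie_apply_three, lie_apply_four] <;> ring

instance : LieAlgebra ℝ G537 where
  lie_smul t x y := by
    apply ext_coords <;> simp only [smul_apply, lie_apply_zero, lie_apply_one, lie_apply_two,
      lie_apply_three, lie_apply_four] <;> ring

end G537

/-- The space `ℂ³`; the coordinates `(z₁, z₂, w)` of `z` are `(z 0, z 1, z 2)`. -/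
abbrev C3 : Type := Fin 3 → ℂ

/-- A holomorphic realization of `𝔤_{5,37}` on an open set `U ⊆ ℂ³`: a faithful representation
by holomorphic vector fields on `U`. The vector field `f ∂/∂z₁ + g ∂/∂z₂ + h ∂/∂w` is given by
its coefficient map `(f, g, h)`; only the values on `U` matter. -/
structure IsHolomorphicRealization (U : Set C3) (ρ : G537 →ₗ[ℝ] (C3 → C3)) : Prop where
  isOpen : IsOpen U
  holomorphic : ∀ x, DifferentiableOn ℂ (ρ x) U
  map_lie : ∀ x y, ∀ z ∈ U, ρ ⁅x, y⁆ z = VectorField.lieBracket ℂ (ρ x) (ρ y) z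
  faithful : ∀ x, (∀ z ∈ U, ρ x z = 0) → x = 0

/-- `Φ` is a real-analytic defining function of `M` near the point `p ∈ M`. -/
structure IsDefiningFunctionAt (M : Set C3) (p : C3) (Φ : C3 → ℝ) : Prop where
  analyticAt : AnalyticAt ℝ Φ p
  fderiv_ne_zero : fderiv ℝ Φ p ≠ 0
  mem_iff : ∀ᶠ q in 𝓝 p, q ∈ M ↔ Φ q = 0

/-- An (embedded, not necessarily closed) real-analytic hypersurface in `ℂ³`. -/
def IsRealAnalyticHypersurface (M : Set C3) : Prop :=
  ∀ p ∈ M, ∃ Φ, IsDefiningFunctionAt M p Φ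

/-- The values at `p` of the vector fields of a realization, as an `ℝ`-linear map. A field `X`
corresponds to the real vector field `2 Re X`, whose value at `p` is the vector `X p` of
`ℂ³ = ℝ⁶`. -/
def evalAt (ρ : G537 →ₗ[ℝ] (C3 → C3)) (p : C3) : G537 →ₗ[ℝ] C3 :=
  (LinearMap.proj p).comp ρ

/-- A five-dimensional orbit in `U`: a connected real-analytic hypersurface `M ⊆ U` such that at
each of its points the values of the fields fill exactly the real tangent space
`T_p M = ker dΦ(p)`. -/
structure IsFiveDimensionalOrbit (U : Set C3) (ρ : G537 →ₗ[ℝ] (C3 → C3)) (M : Set C3) :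
    Prop where
  subset : M ⊆ U
  isConnected : IsConnected M
  hypersurface : IsRealAnalyticHypersurface M
  range_eq_tangent : ∀ p ∈ M, ∀ Φ, IsDefiningFunctionAt M p Φ →
    LinearMap.range (evalAt ρ p) = LinearMap.ker (fderiv ℝ Φ p : C3 →ₗ[ℝ] ℝ)

/-- The complex tangent space `T_p M ∩ i T_p M` of the hypersurface `Φ = 0`. -/
def complexTangent (Φ : C3 → ℝ) (p : C3) : Set C3 :=
  {ξ | fderiv ℝ Φ p ξ = 0 ∧ fderiv ℝ Φ p (Complex.I • ξ) = 0}

/-- The Levi form `∑ ∂²Φ/∂z_j∂z̄_k (p) ξ_j η̄_k`. Here the (1,0)-derivative along `ξ` is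
`(D_ξ - i D_{iξ})/2`, and the (0,1)-derivative along `η` is `(D_η + i D_{iη})/2`. -/
def leviForm (Φ : C3 → ℝ) (p ξ η : C3) : ℂ :=
  let H : C3 → C3 → ℝ := fun a b => fderiv ℝ (fderiv ℝ Φ) p a b
  (1 / 4 : ℂ) *
    (((H ξ η + H (Complex.I • ξ) (Complex.I • η) : ℝ) : ℂ) +
      Complex.I * ((H ξ (Complex.I • η) - H (Complex.I • ξ) η : ℝ) : ℂ))

/-- At each point of `M` the Levi form is nondegenerate on the complex tangent space (this does
not depend on the defining function). -/
def IsLeviNondegenerate (M : Set C3) : Prop :=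
  ∀ p ∈ M, ∀ Φ, IsDefiningFunctionAt M p Φ →
    ∀ ξ ∈ complexTangent Φ p, (∀ η ∈ complexTangent Φ p, leviForm Φ p ξ η = 0) → ξ = 0

/-- The quadric `v = |z₁|² + ε |z₂|²`, where `v = Im w`. -/
def quadric (ε : ℝ) : Set C3 :=
  {z | (z 2).im = ‖z 0‖ ^ 2 + ε * ‖z 1‖ ^ 2}

/-- `M` is, near each of its points, biholomorphic to an open piece of `Q`: there is a
biholomorphic map `F` from a neighbourhood of `p` onto an open set that takes the part of `M` in
its domain onto the part of `Q` in its range. -/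
def IsLocallyBiholomorphicTo (M Q : Set C3) : Prop :=
  ∀ p ∈ M, ∃ F : OpenPartialHomeomorph C3 C3, p ∈ F.source ∧
    DifferentiableOn ℂ F F.source ∧ DifferentiableOn ℂ F.symm F.target ∧ F.IsImage M Q

/-- A spherical hypersurface: locally biholomorphic to `v = |z₁|² + |z₂|²` or to
`v = |z₁|² - |z₂|²`. -/
def IsSpherical (M : Set C3) : Prop :=
  IsLocallyBiholomorphicTo M (quadric 1) ∨ IsLocallyBiholomorphicTo M (quadric (-1))

end

/-!
Over `ℂ` the algebra has the basis `e₁`, `a = e₂ + i e₃`, `b = e₂ - i e₃`, `e₄`, `e₅`, in which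
`[a, b] = -2i e₁` and `e₄`, `e₅` act diagonally. Fix a point `p` of the orbit; `e₁` does not vanish
at `p`, since the five values at `p` are independent over `ℝ`. Up to the automorphism that
exchanges `a` and `b` there are four possibilities.

* `e₁`, `a`, `b` are independent over `ℂ` at `p`. In suitable coordinates `(x, y, u)` the fields
  are explicit, and the real functions `Im u + |x|² - |y|²` and `|x - ȳ|²` are both multiplied by
  the same factor under every field. Their quotient is thus constant on the orbit, which becomes
  `Im (u + 2ikxy) = (k - 1)|x|² + (k + 1)|y|²`.
* `a` lies in the plane spanned by `e₁` and `b`, but `e₄` does not. Either the same argument gives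
  `Im w = |z|² / 4 + k |ζ|²`, or the orbit is a level set of the imaginary part of a holomorphic
  function, hence Levi flat.
* `a` and `e₄` lie in that plane, but `e₅` does not. The orbit is again Levi flat.
* All fields lie in that plane. Then they cannot span the tangent space, which is a real
  hyperplane.

Levi nondegeneracy makes both coefficients of the quadratic equation nonzero, so the orbit is a
quadric near `p`. Signature distinguishes the two quadrics up to local biholomorphism, so
connectedness yields the same quadric at every point.
-/

noncomputable section

section Osgood

open MeasureTheory Metric Set

variable {F : Type*} [NormedAddCommGroup F] [NormedSpace ℂ F] {n : ℕ}

theorem continuous_torusMap (c : Fin n → ℂ) (R : Fin n → ℝ) : Continuous (torusMap c R) := by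
  unfold torusMap
  fun_prop

theorem torusMap_mem_closedBall (c : Fin n → ℂ) {R : ℝ} (hR : 0 ≤ R) (θ : Fin n → ℝ) :
    torusMap c (fun _ => R) θ ∈ closedBall c R := by
  rw [mem_closedBall, dist_pi_le_iff hR]
  exact fun i => circleMap_mem_closedBall (c i) hR (θ i)

theorem torusMap_apply_ne {c w : Fin n → ℂ} {R : ℝ} (hw : w ∈ ball c R) (θ : Fin n → ℝ)
    (i : Fin n) : torusMap c (fun _ => R) θ i ≠ w i :=
  circleMap_ne_mem_ball ((dist_le_pi_dist w c i).trans_lt hw) (θ i)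

theorem torusIntegrable_cauchyKernel_smul {f : (Fin n → ℂ) → F}
    {c w : Fin n → ℂ} {R : ℝ} (hf : ContinuousOn f (closedBall c R)) (hw : w ∈ ball c R) :
    TorusIntegrable (fun x => (∏ i, (x i - w i)⁻¹) • f x) c (fun _ => R) := by
  have hR : 0 ≤ R := (pos_of_mem_ball hw).le
  have hγ := continuous_torusMap c fun _ => R
  refine Continuous.integrableOn_Icc (.smul ?_ ?_)
  · exact continuous_finsetProd _ fun i _ => (((continuous_apply i).comp hγ).sub
      continuous_const).inv₀ fun θ => sub_ne_zero.2 (torusMap_apply_ne hw θ i)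
  · exact hf.comp_continuous hγ (torusMap_mem_closedBall c hR)

theorem cons_mem_closedBall {c : Fin (n + 1) → ℂ} {R : ℝ} {x : ℂ} {y : Fin n → ℂ}
    (hx : x ∈ closedBall (c 0) R) (hy : y ∈ closedBall (c ∘ Fin.succ) R) :
    (Fin.cons x y : Fin (n + 1) → ℂ) ∈ closedBall c R := by
  have hR : 0 ≤ R := dist_nonneg.trans hx
  rw [mem_closedBall, dist_pi_le_iff hR] at *
  exact Fin.cases (by simpa using hx) (by simpa using hy)

theorem torusIntegral_cauchyKernel_smul [CompleteSpace F] {R : ℝ} : ∀ {n : ℕ}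
    {f : (Fin n → ℂ) → F} {c w : Fin n → ℂ}, DifferentiableOn ℂ f (closedBall c R) →
    w ∈ ball c R → (∯ x in T(c, fun _ => R), (∏ i, (x i - w i)⁻¹) • f x) =
      (2 * Real.pi * Complex.I : ℂ) ^ n • f w
  | 0, f, c, w, _, _ => by simp [Subsingleton.elim w c]
  | n + 1, f, c, w, hf, hw => by
    have hw₀ : w 0 ∈ ball (c 0) R := (dist_le_pi_dist w c 0).trans_lt hw
    have hw' : w ∘ Fin.succ ∈ ball (c ∘ Fin.succ) R :=
      (dist_pi_lt_iff (pos_of_mem_ball hw)).2 fun i => (dist_le_pi_dist w c i.succ).trans_lt hw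
    have hf_left : DifferentiableOn ℂ (fun x => f (Fin.cons x (w ∘ Fin.succ)))
        (closedBall (c 0) R) :=
      hf.comp (by fun_prop) fun x hx => cons_mem_closedBall hx (ball_subset_closedBall hw')
    have hf_right : ∀ x ∈ sphere (c 0) R, DifferentiableOn ℂ (fun y : Fin n → ℂ => f (Fin.cons x y))
        (closedBall (c ∘ Fin.succ) R) := fun x hx =>
      hf.comp (by fun_prop) fun y hy => cons_mem_closedBall (sphere_subset_closedBall hx) hy
    calc (∯ x in T(c, fun _ => R), (∏ i, (x i - w i)⁻¹) • f x)
        = ∮ x in C(c 0, R), (x - w 0)⁻¹ • ∯ y in T(c ∘ Fin.succ, fun _ => R),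
            (∏ i, (y i - (w ∘ Fin.succ) i)⁻¹) • f (Fin.cons x y) := by
          rw [torusIntegral_succ (torusIntegrable_cauchyKernel_smul hf.continuousOn hw)]
          simp only [Fin.prod_univ_succ, Fin.cons_zero, Fin.cons_succ, mul_smul,
            torusIntegral_smul]
          rfl
      _ = ∮ x in C(c 0, R), (2 * Real.pi * Complex.I : ℂ) ^ n •
            (x - w 0)⁻¹ • f (Fin.cons x (w ∘ Fin.succ)) := by
          refine circleIntegral.integral_congr (pos_of_mem_ball hw).le fun x hx => ?_
          rw [torusIntegral_cauchyKernel_smul (hf_right x hx) hw', smul_comm]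
      _ = (2 * Real.pi * Complex.I : ℂ) ^ (n + 1) • f w := by
          rw [circleIntegral.integral_smul, hf_left.circleIntegral_sub_inv_smul hw₀, smul_smul,
            ← pow_succ]
          exact congrArg (_ • f ·) (Fin.cons_self_tail w)

theorem exists_clm_eq_integral {K : Type*} [TopologicalSpace K] [CompactSpace K]
    [MeasurableSpace K] [OpensMeasurableSpace K] (μ : Measure K) [IsFiniteMeasure μ] :
    ∃ L : C(K, ℂ) →L[ℂ] ℂ, ∀ φ, L φ = ∫ x, φ x ∂μ := by
  have integrable (φ : C(K, ℂ)) : Integrable φ μ :=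
    φ.continuous.integrable_of_hasCompactSupport (.of_compactSpace _)
  exact ⟨LinearMap.mkContinuous
    { toFun := fun φ => ∫ x, φ x ∂μ
      map_add' := fun φ ψ => integral_add (integrable φ) (integrable ψ)
      map_smul' := fun c φ => integral_smul c _ }
    (μ.real univ) (fun φ => by
      rw [mul_comm]
      exact norm_integral_le_of_norm_le_const (.of_forall φ.norm_coe_le_norm)), fun _ => rfl⟩

theorem exists_analyticAt_continuousMap_inv {K E : Type*} [TopologicalSpace K] [CompactSpace K]
    [NormedAddCommGroup E] [NormedSpace ℂ E] {u : E → C(K, ℂ)} {p : E} (hu : AnalyticAt ℂ u p)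
    (h0 : ∀ x, u p x ≠ 0) :
    ∃ v : E → C(K, ℂ), AnalyticAt ℂ v p ∧ ∀ᶠ q in 𝓝 p, ∀ x, v q x = (u q x)⁻¹ := by
  obtain ⟨a, ha⟩ := (u p).isUnit_iff_forall_ne_zero.2 h0
  refine ⟨fun q => Ring.inverse (u q), .fun_comp (g := Ring.inverse) ?_ hu, ?_⟩
  · exact ha ▸ analyticAt_inverse a
  filter_upwards [hu.continuousAt.eventually (ha ▸ Units.nhds a)] with q hq x
  exact eq_inv_of_mul_eq_one_right (DFunLike.congr_fun (Ring.mul_inverse_cancel _ hq) x)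

theorem analyticAt_cauchyIntegral {f : (Fin n → ℂ) → ℂ} {p : Fin n → ℂ} {R : ℝ} (hR : 0 < R)
    (hf : ContinuousOn f (closedBall p R)) :
    AnalyticAt ℂ (fun w => ∯ x in T(p, fun _ => R), (∏ i, (x i - w i)⁻¹) • f x) p := by
  let K := Icc (0 : Fin n → ℝ) fun _ => 2 * Real.pi
  let γ : C(K, Fin n → ℂ) := ⟨fun θ => torusMap p (fun _ => R) θ,
    (continuous_torusMap p _).comp continuous_subtype_val⟩
  let φ : C(K, ℂ) :=
    ⟨fun θ => (∏ i, R * Complex.exp (θ.1 i * Complex.I) * Complex.I) * f (γ θ),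
      .mul (continuous_finsetProd _ fun i _ => by
        have : Continuous fun θ : K => (θ.1 i : ℂ) :=
          Complex.continuous_ofReal.comp ((continuous_apply i).comp continuous_subtype_val)
        fun_prop) (hf.comp_continuous γ.continuous fun θ =>
        torusMap_mem_closedBall p hR.le θ)⟩
  let u (i : Fin n) (w : Fin n → ℂ) : C(K, ℂ) :=
    (⟨fun θ => γ θ i, by fun_prop⟩ : C(K, ℂ)) - w i • 1
  have hu (i : Fin n) : AnalyticAt ℂ (u i) p :=
    have hcoord : AnalyticAt ℂ (fun w : Fin n → ℂ => w i) p :=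
      (ContinuousLinearMap.proj (R := ℂ) (φ := fun _ : Fin n => ℂ) i).analyticAt p
    analyticAt_const.sub (hcoord.fun_smul analyticAt_const)
  have hu_apply (i w θ) : u i w θ = torusMap p (fun _ => R) θ i - w i := by simp [u, γ]
  choose v hv hvu using fun i => exists_analyticAt_continuousMap_inv (hu i) fun θ => by
    rw [hu_apply]
    exact sub_ne_zero.2 (torusMap_apply_ne (mem_ball_self hR) θ i)
  let _ : MeasureSpace K := Measure.Subtype.measureSpace
  have : IsFiniteMeasure (volume : Measure K) := ⟨by
    rw [Measure.Subtype.volume_univ measurableSet_Icc.nullMeasurableSet]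
    exact measure_Icc_lt_top⟩
  obtain ⟨L, hL⟩ := exists_clm_eq_integral (volume : Measure K)
  have analytic : AnalyticAt ℂ (fun w => L ((∏ i, v i w) * φ)) p :=
    .fun_comp (L.analyticAt _)
      (.mul (Finset.analyticAt_fun_prod _ fun i _ => hv i) analyticAt_const)
  refine analytic.congr ?_
  filter_upwards [Filter.eventually_all.2 hvu] with w hw
  rw [hL, torusIntegral, ← integral_subtype measurableSet_Icc]
  refine integral_congr_ae (.of_forall fun θ => ?_)
  simp only [ContinuousMap.mul_apply, ContinuousMap.prod_apply, hw, hu_apply, φ,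
    ContinuousMap.coe_mk, smul_eq_mul, γ]
  ring

theorem analyticAt_of_differentiableOn {f : (Fin n → ℂ) → ℂ} {U : Set (Fin n → ℂ)}
    {p : Fin n → ℂ} (hf : DifferentiableOn ℂ f U) (hU : U ∈ 𝓝 p) : AnalyticAt ℂ f p := by
  obtain ⟨R, hR, hRU⟩ := nhds_basis_closedBall.mem_iff.mp hU
  replace hf := hf.mono hRU
  refine ((analyticAt_const (v := ((2 * Real.pi * Complex.I : ℂ) ^ n)⁻¹)).fun_mul
    (analyticAt_cauchyIntegral hR hf.continuousOn)).congr ?_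
  filter_upwards [ball_mem_nhds p hR] with w hw
  rw [torusIntegral_cauchyKernel_smul hf hw]
  exact inv_smul_smul₀ (pow_ne_zero n Complex.two_pi_I_ne_zero) (f w)

theorem analyticAt_of_eventually_differentiableAt {f : (Fin n → ℂ) → ℂ} {p : Fin n → ℂ}
    (hf : ∀ᶠ q in 𝓝 p, DifferentiableAt ℂ f q) : AnalyticAt ℂ f p :=
  analyticAt_of_differentiableOn (fun _ hq => DifferentiableAt.differentiableWithinAt hq) hf

end Osgood

section LevelSets

variable {E : Type*} [NormedAddCommGroup E] [NormedSpace ℝ E]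

open Metric in
theorem eventually_eq_iff_of_fderiv_eq_zero_of_linear {l : E →L[ℝ] ℝ} {J : E → ℝ} {x₀ : E}
    (hJ : ContDiffAt ℝ 1 J x₀) (hJ₀ : fderiv ℝ J x₀ ≠ 0)
    (htan : ∀ᶠ x in 𝓝 x₀, l x = l x₀ → ∀ v, l v = 0 → fderiv ℝ J x v = 0) :
    ∀ᶠ x in 𝓝 x₀, l x = l x₀ ↔ J x = J x₀ := by
  obtain ⟨n, hn⟩ : ∃ n, l n = 1 := by
    by_contra! hl
    have l_eq_zero (v : E) : l v = 0 := by
      by_contra hv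
      exact hl ((l v)⁻¹ • v) (by simp [hv])
    exact hJ₀ (ContinuousLinearMap.ext fun v => htan.self_of_nhds rfl v (l_eq_zero v))
  have hJn : fderiv ℝ J x₀ n ≠ 0 := fun h => hJ₀ <| by
    ext v
    have : fderiv ℝ J x₀ (v - l v • n) = 0 := htan.self_of_nhds rfl _ (by simp [hn])
    simpa [h] using this
  have hJn' : ∀ᶠ x in 𝓝 x₀, fderiv ℝ J x n ≠ 0 :=
    ((hJ.continuousAt_fderiv one_ne_zero).clm_apply continuousAt_const).eventually_ne hJn
  have hJd : ∀ᶠ x in 𝓝 x₀, DifferentiableAt ℝ J x :=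
    (hJ.eventually (by simp)).mono fun x hx => hx.differentiableAt one_ne_zero
  obtain ⟨ε, hε, hball⟩ := eventually_nhds_iff_ball.1 (hJd.and (hJn'.and htan))
  have mvt {x y : E} (hx : x ∈ ball x₀ ε) (hy : y ∈ ball x₀ ε) :
      ∃ z ∈ ball x₀ ε, z ∈ segment ℝ x y ∧ J y - J x = fderiv ℝ J z (y - x) := by
    obtain ⟨z, hz, h⟩ := domain_mvt
      (fun z hz => (hball z hz).1.hasFDerivAt.hasFDerivWithinAt) (convex_ball x₀ ε) hx hy
    exact ⟨z, (convex_ball x₀ ε).segment_subset hx hy hz, hz, h⟩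
  let π : E → E := fun x => x - (l x - l x₀) • n
  have hπ : ∀ᶠ x in 𝓝 x₀, π x ∈ ball x₀ ε :=
    (by fun_prop : ContinuousAt π x₀).eventually_mem (by simpa [π] using ball_mem_nhds x₀ hε)
  filter_upwards [hπ, ball_mem_nhds x₀ hε] with x hπx hx
  have hlπ : l (π x) = l x₀ := by simp [π, hn]
  obtain ⟨z, hz, hz_seg, h₁⟩ := mvt (mem_ball_self hε) hπx
  obtain ⟨y, hy, -, h₂⟩ := mvt hπx hx
  have hlz : l z = l x₀ := by
    obtain ⟨t, -, rfl⟩ := segment_eq_image_lineMap ℝ x₀ (π x) ▸ hz_seg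
    simp [AffineMap.lineMap_apply, hlπ]
  have J_π : J (π x) - J x₀ = 0 := h₁.trans ((hball z hz).2.2 hlz _ (by simp [hlπ]))
  have hJx : J x - J x₀ = (l x - l x₀) * fderiv ℝ J y n := by
    have : x - π x = (l x - l x₀) • n := by simp [π]
    rw [this, map_smul, smul_eq_mul] at h₂
    linarith
  rw [← sub_eq_zero (a := J x), hJx, mul_eq_zero, or_iff_left (hball y hy).2.1, sub_eq_zero]

variable [CompleteSpace E]

theorem exists_straightening {Φ : E → ℝ} {p : E} (hΦ : ContDiffAt ℝ 1 Φ p)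
    (hΦ₀ : fderiv ℝ Φ p ≠ 0) :
    ∃ G : OpenPartialHomeomorph E E, p ∈ G.source ∧ ContDiffAt ℝ 1 G.symm (G p) ∧
      fderiv ℝ G.symm (G p) = .id ℝ E ∧ ∀ q, fderiv ℝ Φ p (G q) = Φ q := by
  obtain ⟨m, hm⟩ := DFunLike.ne_iff.1 hΦ₀
  set l := fderiv ℝ Φ p
  obtain ⟨n, hn⟩ : ∃ n, l n = 1 := ⟨(l m)⁻¹ • m, by simpa using inv_mul_cancel₀ hm⟩
  let Ψ : E → E := fun q => q + (Φ q - l q) • n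
  have hΨ : ContDiffAt ℝ 1 Ψ p :=
    contDiffAt_id.add ((hΦ.sub l.contDiff.contDiffAt).smul contDiffAt_const)
  have hΨ' : HasFDerivAt Ψ ((ContinuousLinearEquiv.refl ℝ E : E ≃L[ℝ] E) : E →L[ℝ] E) p := by
    have hΦ' : HasFDerivAt Φ l p := (hΦ.differentiableAt one_ne_zero).hasFDerivAt
    have := (hasFDerivAt_id p).add ((hΦ'.sub l.hasFDerivAt).smul_const n)
    rwa [sub_self, ContinuousLinearMap.zero_smulRight, add_zero] at this
  let G := hΨ.toOpenPartialHomeomorph Ψ hΨ' one_ne_zero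
  have hp : p ∈ G.source := hΨ.mem_toOpenPartialHomeomorph_source hΨ' one_ne_zero
  have hG : HasFDerivAt G.symm (.id ℝ E) (G p) :=
    G.hasFDerivAt_symm (f' := .refl ℝ E) (G.map_source hp) (by rwa [G.left_inv hp])
  exact ⟨G, hp, hΨ.to_localInverse hΨ' one_ne_zero, hG.fderiv, fun q => by simp [G, Ψ, hn]⟩

theorem eventually_eq_iff_of_fderiv_eq_zero {Φ I : E → ℝ} {p : E} (hΦ : ContDiffAt ℝ 1 Φ p)
    (hI : ContDiffAt ℝ 1 I p) (hΦ₀ : fderiv ℝ Φ p ≠ 0) (hI₀ : fderiv ℝ I p ≠ 0)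
    (htan : ∀ᶠ q in 𝓝 p, Φ q = Φ p → ∀ v, fderiv ℝ Φ q v = 0 → fderiv ℝ I q v = 0) :
    ∀ᶠ q in 𝓝 p, Φ q = Φ p ↔ I q = I p := by
  obtain ⟨G, hp, hG, hG', hGΦ⟩ := exists_straightening hΦ hΦ₀
  set l := fderiv ℝ Φ p
  set g := G.symm
  have hgp : g (G p) = p := G.left_inv hp
  have tendsto_g : Filter.Tendsto g (𝓝 (G p)) (𝓝 p) := by simpa [hgp] using hG.continuousAt.tendsto
  have fderiv_comp_g {f : E → ℝ} (hf : ContDiffAt ℝ 1 f p) :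
      ∀ᶠ x in 𝓝 (G p), fderiv ℝ (f ∘ g) x = (fderiv ℝ f (g x)).comp (fderiv ℝ g x) := by
    filter_upwards [tendsto_g.eventually (hf.eventually (by simp)), hG.eventually (by simp)]
      with x hfx hgx
    exact fderiv_comp x (hfx.differentiableAt one_ne_zero) (hgx.differentiableAt one_ne_zero)
  have Φ_comp_g : Φ ∘ g =ᶠ[𝓝 (G p)] l := by
    filter_upwards [G.open_target.mem_nhds (G.map_source hp)] with x hx
    rw [Function.comp_apply, ← hGΦ, G.right_inv hx]
  have straight : ∀ᶠ x in 𝓝 (G p), l x = l (G p) ↔ (I ∘ g) x = (I ∘ g) (G p) := by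
    refine eventually_eq_iff_of_fderiv_eq_zero_of_linear (.comp _ (by rwa [hgp]) hG) ?_ ?_
    · rwa [(fderiv_comp_g hI).self_of_nhds, hgp, hG', ContinuousLinearMap.comp_id]
    filter_upwards [tendsto_g.eventually htan, Φ_comp_g.eventually_nhds, fderiv_comp_g hI,
      fderiv_comp_g hΦ] with x h hx hI' hΦ' hl v hv
    rw [hI']
    refine h (by rw [← hGΦ p, ← hl]; exact hx.self_of_nhds) _ ?_
    change ((fderiv ℝ Φ (g x)).comp (fderiv ℝ g x)) v = 0
    rwa [← hΦ', Filter.EventuallyEq.fderiv_eq hx, l.fderiv]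
  filter_upwards [(G.continuousAt hp).eventually straight, G.open_source.mem_nhds hp] with q hq hqs
  simpa [hGΦ, g, hqs, hp] using hq

theorem exists_eventually_eq_iff_eq_mul {Φ r s : E → ℝ} {p ξ : E} (hΦ : ContDiffAt ℝ 1 Φ p)
    (hr : ContDiffAt ℝ 1 r p) (hs : ContDiffAt ℝ 1 s p) (hΦ₀ : fderiv ℝ Φ p ≠ 0) (hs₀ : s p ≠ 0)
    (hrξ : fderiv ℝ r p ξ ≠ 0) (hsξ : fderiv ℝ s p ξ = 0)
    (htan : ∀ᶠ q in 𝓝 p, Φ q = Φ p → ∀ v, fderiv ℝ Φ q v = 0 →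
      ∃ a : ℝ, fderiv ℝ r q v = a * r q ∧ fderiv ℝ s q v = a * s q) :
    ∃ c : ℝ, ∀ᶠ q in 𝓝 p, Φ q = Φ p ↔ r q = c * s q := by
  have hs_ne : ∀ᶠ q in 𝓝 p, s q ≠ 0 := hs.continuousAt.eventually_ne hs₀
  have fderiv_quotient : ∀ᶠ q in 𝓝 p, ∀ v, fderiv ℝ (fun q => r q / s q) q v =
      (s q * fderiv ℝ r q v - r q * fderiv ℝ s q v) / s q ^ 2 := by
    filter_upwards [hs_ne, hr.eventually (by simp), hs.eventually (by simp)] with q hsq hrq hsq' v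
    have := (hrq.differentiableAt one_ne_zero).hasFDerivAt.mul
      ((hasDerivAt_inv hsq).comp_hasFDerivAt q (hsq'.differentiableAt one_ne_zero).hasFDerivAt)
    rw [HasFDerivAt.fderiv (f := fun q => r q / s q) this]
    simp only [Function.comp_apply, add_apply, smul_apply, smul_eq_mul]
    field_simp
    ring
  -- By `htan` the tangential derivatives of `r / s` vanish, so it is constant along the level set.
  have level := eventually_eq_iff_of_fderiv_eq_zero hΦ (hr.fun_div hs hs₀) hΦ₀ ?_ ?_
  · refine ⟨r p / s p, ?_⟩
    filter_upwards [level, hs_ne] with q hq hsq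
    rw [hq, div_eq_iff hsq]
  · refine DFunLike.ne_iff.2 ⟨ξ, ?_⟩
    rw [fderiv_quotient.self_of_nhds, hsξ]
    simpa using ⟨⟨hs₀, hrξ⟩, hs₀⟩
  · filter_upwards [htan, fderiv_quotient] with q hq hquot hΦq v hv
    obtain ⟨a, har, has⟩ := hq hΦq v hv
    rw [hquot, har, has]
    ring

end LevelSets

section RealDerivatives

variable {E : Type*} [NormedAddCommGroup E] [NormedSpace ℝ E] {f : E → ℂ} {f' : E →L[ℝ] ℂ} {p : E}

theorem fderiv_fderiv_apply_of_eventually {Φ g : E → ℝ} {g' : E →L[ℝ] ℝ} {b : E}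
    (hΦ : ContDiffAt ℝ 2 Φ p) (h : ∀ᶠ q in 𝓝 p, fderiv ℝ Φ q b = g q) (hg : HasFDerivAt g g' p)
    (a : E) : fderiv ℝ (fderiv ℝ Φ) p a b = g' a := by
  have hΦ' : DifferentiableAt ℝ (fderiv ℝ Φ) p :=
    (hΦ.fderiv_right (m := 1) (by norm_num)).differentiableAt one_ne_zero
  have := (hΦ'.hasFDerivAt.clm_apply (hasFDerivAt_const b p)).unique
    (hg.congr_of_eventuallyEq h)
  simpa using DFunLike.congr_fun this a

theorem hasFDerivAt_im (hf : HasFDerivAt f f' p) :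
    HasFDerivAt (fun q => (f q).im) (Complex.imCLM.comp f') p :=
  Complex.imCLM.hasFDerivAt.comp p hf

theorem fderiv_norm_sq_apply_of_hasFDerivAt (hf : HasFDerivAt f f' p) (b : E) :
    fderiv ℝ (fun q => ‖f q‖ ^ 2) p b = 2 * inner ℝ (f p) (f' b) := by
  rw [hf.norm_sq.fderiv]
  exact (two_nsmul _).trans (two_mul _).symm

variable [NormedSpace ℂ E] [IsScalarTower ℝ ℂ E]

theorem analyticAt_im (hf : AnalyticAt ℂ f p) : AnalyticAt ℝ (fun q => (f q).im) p :=
  (Complex.imCLM.analyticAt _).comp (hf.restrictScalars (𝕜 := ℝ))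

theorem analyticAt_norm_sq (hf : AnalyticAt ℂ f p) : AnalyticAt ℝ (fun q => ‖f q‖ ^ 2) p := by
  have hre : AnalyticAt ℝ (fun q => (f q).re) p :=
    (Complex.reCLM.analyticAt _).comp (hf.restrictScalars (𝕜 := ℝ))
  simp only [Complex.sq_norm, Complex.normSq_apply]
  exact (hre.fun_mul hre).fun_add ((analyticAt_im hf).fun_mul (analyticAt_im hf))

theorem hasFDerivAt_restrictScalars (hf : AnalyticAt ℂ f p) :
    HasFDerivAt f ((fderiv ℂ f p).restrictScalars ℝ) p :=
  hf.differentiableAt.hasFDerivAt.restrictScalars ℝ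

theorem hasFDerivAt_fderiv_apply (hf : AnalyticAt ℂ f p) (b : E) :
    HasFDerivAt (fun q => fderiv ℂ f q b)
      (((fderiv ℂ (fderiv ℂ f) p).flip b).restrictScalars ℝ) p := by
  have h := hf.fderiv.differentiableAt.hasFDerivAt.clm_apply (hasFDerivAt_const b p)
  exact (h.restrictScalars ℝ).congr_fderiv (by ext; simp)

theorem fderiv_im_apply (hf : AnalyticAt ℂ f p) (b : E) :
    fderiv ℝ (fun q => (f q).im) p b = (fderiv ℂ f p b).im := by
  rw [(hasFDerivAt_im (hasFDerivAt_restrictScalars hf)).fderiv]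
  rfl

theorem fderiv_norm_sq_comp_apply (hf : AnalyticAt ℂ f p) (b : E) :
    fderiv ℝ (fun q => ‖f q‖ ^ 2) p b = 2 * inner ℝ (f p) (fderiv ℂ f p b) :=
  fderiv_norm_sq_apply_of_hasFDerivAt (hasFDerivAt_restrictScalars hf) b

end RealDerivatives

section LeviForm

open ComplexConjugate

theorem leviForm_eq_iteratedFDeriv (Φ : C3 → ℝ) (p ξ η : C3) :
    leviForm Φ p ξ η = (1 / 4 : ℂ) *
      (((iteratedFDeriv ℝ 2 Φ p ![ξ, η] +
          iteratedFDeriv ℝ 2 Φ p ![Complex.I • ξ, Complex.I • η] : ℝ) : ℂ) +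
        Complex.I * ((iteratedFDeriv ℝ 2 Φ p ![ξ, Complex.I • η] -
          iteratedFDeriv ℝ 2 Φ p ![Complex.I • ξ, η] : ℝ) : ℂ)) := by
  simp only [iteratedFDeriv_two_apply]
  rfl

variable {Φ Ψ : C3 → ℝ} {p : C3}

theorem leviForm_fun_sub (hΦ : ContDiffAt ℝ 2 Φ p) (hΨ : ContDiffAt ℝ 2 Ψ p) (ξ η : C3) :
    leviForm (fun q => Φ q - Ψ q) p ξ η = leviForm Φ p ξ η - leviForm Ψ p ξ η := by
  simp only [leviForm_eq_iteratedFDeriv, fun_iteratedFDeriv_sub_apply hΦ hΨ, sub_apply]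
  push_cast
  ring

theorem leviForm_const_mul (κ : ℝ) (hΦ : ContDiffAt ℝ 2 Φ p) (ξ η : C3) :
    leviForm (fun q => κ * Φ q) p ξ η = κ * leviForm Φ p ξ η := by
  have iteratedFDeriv_mul : iteratedFDeriv ℝ 2 (fun q => κ * Φ q) p = κ • iteratedFDeriv ℝ 2 Φ p :=
    iteratedFDeriv_const_smul_apply' (a := κ) (f := Φ) hΦ
  rw [leviForm_eq_iteratedFDeriv, leviForm_eq_iteratedFDeriv, iteratedFDeriv_mul]
  simp only [smul_apply, smul_eq_mul]
  push_cast
  ring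

theorem leviForm_fun_sum {ι : Type*} {s : Finset ι} {Φ : ι → C3 → ℝ}
    (hΦ : ∀ i ∈ s, ContDiffAt ℝ 2 (Φ i) p) (ξ η : C3) :
    leviForm (fun q => ∑ i ∈ s, Φ i q) p ξ η = ∑ i ∈ s, leviForm (Φ i) p ξ η := by
  simp only [leviForm_eq_iteratedFDeriv, iteratedFDeriv_fun_sum_apply hΦ,
    sum_apply, ← Finset.mul_sum, Finset.sum_add_distrib,
    Finset.sum_sub_distrib, Complex.ofReal_add, Complex.ofReal_sub, Complex.ofReal_sum]

variable {f : C3 → ℂ}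

theorem leviForm_im (hf : AnalyticAt ℂ f p) (ξ η : C3) :
    leviForm (fun q => (f q).im) p ξ η = 0 := by
  have hessian (a b : C3) : fderiv ℝ (fderiv ℝ fun q => (f q).im) p a b =
      (fderiv ℂ (fderiv ℂ f) p a b).im :=
    fderiv_fderiv_apply_of_eventually (analyticAt_im hf).contDiffAt
      (hf.eventually_analyticAt.mono fun q hq => fderiv_im_apply hq b)
      (hasFDerivAt_im (hasFDerivAt_fderiv_apply hf b)) a
  simp [leviForm, hessian]

theorem leviForm_norm_sq (hf : AnalyticAt ℂ f p) (ξ η : C3) :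
    leviForm (fun q => ‖f q‖ ^ 2) p ξ η = fderiv ℂ f p ξ * conj (fderiv ℂ f p η) := by
  have hessian (a b : C3) : fderiv ℝ (fderiv ℝ fun q => ‖f q‖ ^ 2) p a b =
      2 * (inner ℝ (f p) (fderiv ℂ (fderiv ℂ f) p a b) +
        inner ℝ (fderiv ℂ f p a) (fderiv ℂ f p b)) :=
    fderiv_fderiv_apply_of_eventually (analyticAt_norm_sq hf).contDiffAt
      (hf.eventually_analyticAt.mono fun q hq => fderiv_norm_sq_comp_apply hq b)
      (((hasFDerivAt_restrictScalars hf).inner ℝ (hasFDerivAt_fderiv_apply hf b)).const_mul 2) a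
  apply Complex.ext <;> simp [leviForm, hessian, Complex.inner] <;> ring

variable {ι : Type*} [Fintype ι] {W : C3 → ℂ} {Z : ι → C3 → ℂ} {κ : ι → ℝ}

theorem analyticAt_im_sub_sum (hW : AnalyticAt ℂ W p) (hZ : ∀ i, AnalyticAt ℂ (Z i) p) :
    AnalyticAt ℝ (fun q => (W q).im - ∑ i, κ i * ‖Z i q‖ ^ 2) p :=
  (analyticAt_im hW).fun_sub <| Finset.analyticAt_fun_sum _ fun i _ =>
    analyticAt_const.fun_mul (analyticAt_norm_sq (hZ i))

theorem fderiv_im_sub_sum_apply (hW : AnalyticAt ℂ W p) (hZ : ∀ i, AnalyticAt ℂ (Z i) p) (b : C3) :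
    fderiv ℝ (fun q => (W q).im - ∑ i, κ i * ‖Z i q‖ ^ 2) p b =
      (fderiv ℂ W p b).im - ∑ i, κ i * (2 * inner ℝ (Z i p) (fderiv ℂ (Z i) p b)) := by
  have hN (i : ι) := (analyticAt_norm_sq (hZ i)).differentiableAt
  rw [fderiv_fun_sub (analyticAt_im hW).differentiableAt
    (DifferentiableAt.fun_sum fun i _ => (hN i).const_mul (κ i)), sub_apply, fderiv_im_apply hW,
    fderiv_fun_sum fun i _ => (hN i).const_mul (κ i), sum_apply]
  simp only [fderiv_const_mul (hN _), smul_apply, smul_eq_mul, fderiv_norm_sq_comp_apply (hZ _)]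

theorem leviForm_im_sub_sum (hW : AnalyticAt ℂ W p) (hZ : ∀ i, AnalyticAt ℂ (Z i) p) (ξ η : C3) :
    leviForm (fun q => (W q).im - ∑ i, κ i * ‖Z i q‖ ^ 2) p ξ η =
      -∑ i, κ i * (fderiv ℂ (Z i) p ξ * conj (fderiv ℂ (Z i) p η)) := by
  have hN (i : ι) : ContDiffAt ℝ 2 (fun q => ‖Z i q‖ ^ 2) p :=
    (analyticAt_norm_sq (hZ i)).contDiffAt
  rw [leviForm_fun_sub (analyticAt_im hW).contDiffAt
    (ContDiffAt.sum fun i _ => contDiffAt_const.mul (hN i)), leviForm_im hW,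
    leviForm_fun_sum fun i _ => contDiffAt_const.mul (hN i), zero_sub]
  simp only [leviForm_const_mul _ (hN _), leviForm_norm_sq (hZ _)]

theorem eq_zero_of_stationary {M : Set C3} {v ξ : C3} (hLevi : IsLeviNondegenerate M)
    (hp : p ∈ M) (hW : AnalyticAt ℂ W p) (hZ : ∀ i, AnalyticAt ℂ (Z i) p)
    (hM : ∀ᶠ q in 𝓝 p, q ∈ M ↔ (W q).im = ∑ i, κ i * ‖Z i q‖ ^ 2)
    (hvW : fderiv ℂ W p v ≠ 0) (hvZ : ∀ i, κ i = 0 ∨ fderiv ℂ (Z i) p v = 0)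
    (hξW : fderiv ℂ W p ξ = 0) (hξZ : ∀ i, κ i = 0 ∨ fderiv ℂ (Z i) p ξ = 0) : ξ = 0 := by
  have fderiv_eq {u : C3} (hu : ∀ i, κ i = 0 ∨ fderiv ℂ (Z i) p u = 0) (t : ℂ) :
      fderiv ℝ (fun q => (W q).im - ∑ i, κ i * ‖Z i q‖ ^ 2) p (t • u) =
        (t * fderiv ℂ W p u).im := by
    rw [fderiv_im_sub_sum_apply hW hZ, map_smul, smul_eq_mul, sub_eq_self]
    exact Finset.sum_eq_zero fun i _ => by rcases hu i with h | h <;> simp [h]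
  have hdefining : IsDefiningFunctionAt M p fun q => (W q).im - ∑ i, κ i * ‖Z i q‖ ^ 2 := by
    refine ⟨analyticAt_im_sub_sum hW hZ, fun h => ?_, by simpa only [sub_eq_zero] using hM⟩
    have := fderiv_eq hvZ (Complex.I / fderiv ℂ W p v)
    simp [h, div_mul_cancel₀ _ hvW] at this
  refine hLevi p hp _ hdefining ξ ⟨?_, ?_⟩ fun η _ => ?_
  · simpa [hξW] using fderiv_eq hξZ 1
  · simpa [hξW] using fderiv_eq hξZ Complex.I
  · rw [leviForm_im_sub_sum hW hZ, neg_eq_zero]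
    exact Finset.sum_eq_zero fun i _ => by rcases hξZ i with h | h <;> simp [h]

end LeviForm

/-- `M` is biholomorphic to an open piece of `Q` near `p`: the local condition in
`IsLocallyBiholomorphicTo`, so that it can be compared for different `Q`. -/
def IsBiholomorphicNear (M Q : Set C3) (p : C3) : Prop :=
  ∃ F : OpenPartialHomeomorph C3 C3, p ∈ F.source ∧
    DifferentiableOn ℂ F F.source ∧ DifferentiableOn ℂ F.symm F.target ∧ F.IsImage M Q

section Charts

variable {M : Set C3} {p : C3} {f : C3 → C3}

theorem fderiv_coord_apply (hf : DifferentiableAt ℂ f p) (i : Fin 3) (v : C3) :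
    fderiv ℂ (fun q => f q i) p v = fderiv ℂ f p v i :=
  DFunLike.congr_fun (hasFDerivAt_pi'.1 hf.hasFDerivAt i).fderiv v

theorem isBiholomorphicNear_of_bijective {Q : Set C3} (hf : AnalyticAt ℂ f p)
    (hbij : Function.Bijective (fderiv ℂ f p)) (hM : ∀ᶠ q in 𝓝 p, q ∈ M ↔ f q ∈ Q) :
    IsBiholomorphicNear M Q p := by
  let f' : C3 ≃L[ℂ] C3 :=
    (LinearEquiv.ofBijective (fderiv ℂ f p : C3 →ₗ[ℂ] C3) hbij).toContinuousLinearEquiv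
  have hf' : HasFDerivAt f (f' : C3 →L[ℂ] C3) p :=
    hf.differentiableAt.hasFDerivAt.congr_fderiv (by ext v; rfl)
  have hf₁ : ContDiffAt ℂ 1 f p := hf.contDiffAt
  let G := hf₁.toOpenPartialHomeomorph f hf' one_ne_zero
  have hG : ContDiffAt ℂ 1 G.symm (f p) := hf₁.to_localInverse hf' one_ne_zero
  have hgood : ∀ᶠ q in 𝓝 p, (q ∈ M ↔ f q ∈ Q) ∧ DifferentiableAt ℂ f q ∧
      DifferentiableAt ℂ G.symm (f q) :=
    hM.and <| (hf.eventually_analyticAt.mono fun q hq => hq.differentiableAt).and <|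
      hf₁.continuousAt.eventually <|
        (hG.eventually (by simp)).mono fun x hx => hx.differentiableAt one_ne_zero
  obtain ⟨O, hO, hOopen, hpO⟩ := eventually_nhds_iff.1 hgood
  refine ⟨G.restrOpen O hOopen, ⟨hf₁.mem_toOpenPartialHomeomorph_source hf' one_ne_zero, hpO⟩,
    fun q hq => (hO q hq.2).2.1.differentiableWithinAt, fun x hx => ?_, fun q hq =>
    (hO q hq.2).1.symm⟩
  have hGx := (hO _ hx.2).2.2
  rw [show f (G.symm x) = x from G.right_inv hx.1] at hGx
  exact hGx.differentiableWithinAt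

theorem isBiholomorphicNear_of_linear {Q : Set C3} (A : C3 ≃L[ℂ] C3) (hf : AnalyticAt ℂ f p)
    (hbij : Function.Bijective (fderiv ℂ f p)) (hM : ∀ᶠ q in 𝓝 p, q ∈ M ↔ A (f q) ∈ Q) :
    IsBiholomorphicNear M Q p := by
  refine isBiholomorphicNear_of_bijective (f := fun q => A (f q))
    ((A : C3 →L[ℂ] C3).analyticAt _ |>.comp hf) ?_ hM
  rw [show (fun q => A (f q)) = A ∘ f from rfl,
    (A.hasFDerivAt.comp p hf.differentiableAt.hasFDerivAt).fderiv]
  exact A.bijective.comp hbij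

theorem exists_linear_quadric_iff {κ : Fin 2 → ℝ} (hκ : ∀ i, κ i ≠ 0) :
    ∃ ε : ℝ, (ε = 1 ∨ ε = -1) ∧ ∃ A : C3 ≃L[ℂ] C3, ∀ z : C3,
      (z 2).im = ∑ i, κ i * ‖z i.castSucc‖ ^ 2 ↔ A z ∈ quadric ε := by
  have hratio : κ 1 / κ 0 ≠ 0 := div_ne_zero (hκ 1) (hκ 0)
  obtain ⟨ε, hε, hεratio⟩ : ∃ ε : ℝ, (ε = 1 ∨ ε = -1) ∧ κ 1 / κ 0 = ε * |κ 1 / κ 0| := by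
    rcases abs_choice (κ 1 / κ 0) with h | h
    exacts [⟨1, .inl rfl, by rw [h, one_mul]⟩, ⟨-1, .inr rfl, by rw [h, neg_one_mul, neg_neg]⟩]
  let d : Fin 3 → ℝ := ![1, √|κ 1 / κ 0|, (κ 0)⁻¹]
  have hd (i : Fin 3) : (d i : ℂ) ≠ 0 := by
    have : √|κ 1 / κ 0| ≠ 0 := (Real.sqrt_pos.2 (abs_pos.2 hratio)).ne'
    fin_cases i <;> simp [d, this, hκ 0]
  let A : C3 ≃L[ℂ] C3 := ContinuousLinearEquiv.piCongrRight fun i =>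
    ContinuousLinearEquiv.unitsEquivAut ℂ (Units.mk0 (d i : ℂ) (hd i))
  refine ⟨ε, hε, A, fun z => ?_⟩
  have hA (i : Fin 3) : A z i = z i * d i := rfl
  have hnorm : ‖A z 1‖ ^ 2 = |κ 1 / κ 0| * ‖z 1‖ ^ 2 := by
    rw [hA, norm_mul, mul_pow, Complex.norm_real, Real.norm_eq_abs, sq_abs, mul_comm]
    exact congrArg (· * _) (Real.sq_sqrt (abs_nonneg _))
  have him : (A z 2).im = (z 2).im / κ 0 := by
    rw [hA, Complex.im_mul_ofReal]
    rfl
  rw [quadric, Set.mem_ofPred_eq, hnorm, ← mul_assoc, ← hεratio, him, Fin.sum_univ_two,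
    div_eq_iff (hκ 0)]
  have hA₀ : A z 0 = z 0 := by simp [hA, d]
  have : (‖z 0‖ ^ 2 + κ 1 / κ 0 * ‖z 1‖ ^ 2) * κ 0 = κ 0 * ‖z 0‖ ^ 2 + κ 1 * ‖z 1‖ ^ 2 := by
    field_simp [hκ 0]
  rw [hA₀, this]
  rfl

theorem bijective_of_det_ne_zero {n : ℕ} (L : (Fin n → ℂ) →ₗ[ℂ] (Fin n → ℂ))
    (x : Fin n → Fin n → ℂ) (hdet : (Matrix.of fun i => L (x i)).det ≠ 0) :
    Function.Bijective L := by
  have hspan : Submodule.span ℂ (Set.range fun i => L (x i)) = ⊤ :=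
    (Matrix.linearIndependent_rows_of_det_ne_zero hdet).span_eq_top_of_card_eq_finrank' (by simp)
  have hsurj : Function.Surjective L := by
    rw [← LinearMap.range_eq_top, eq_top_iff, ← hspan, Submodule.span_le]
    rintro _ ⟨i, rfl⟩
    exact ⟨x i, rfl⟩
  exact ⟨LinearMap.injective_iff_surjective.2 hsurj, hsurj⟩

theorem coefficient_ne_zero {κ : Fin 2 → ℝ} (hLevi : IsLeviNondegenerate M) (hp : p ∈ M)
    (hf : AnalyticAt ℂ f p) (hbij : Function.Bijective (fderiv ℂ f p))
    (hM : ∀ᶠ q in 𝓝 p, q ∈ M ↔ (f q 2).im = ∑ i, κ i * ‖f q i.castSucc‖ ^ 2) (i : Fin 2) :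
    κ i ≠ 0 := by
  intro hκ
  obtain ⟨v, hv⟩ := hbij.2 (Pi.single 2 1)
  obtain ⟨ξ, hξ⟩ := hbij.2 (Pi.single i.castSucc 1)
  have hcoord (u : C3) (j : Fin 3) : fderiv ℂ (fun q => f q j) p u = fderiv ℂ f p u j :=
    fderiv_coord_apply hf.differentiableAt j u
  have hanalytic (j : Fin 3) : AnalyticAt ℂ (fun q => f q j) p := analyticAt_pi_iff.1 hf j
  have hξ₀ : ξ = 0 := by
    refine eq_zero_of_stationary (v := v) hLevi hp (hanalytic 2)
      (fun j : Fin 2 => hanalytic j.castSucc) hM ?_ (fun j => .inr ?_) ?_ fun j => ?_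
    · rw [hcoord, hv, Pi.single_eq_same]
      exact one_ne_zero
    · rw [hcoord, hv]
      fin_cases j <;> rfl
    · rw [hcoord, hξ]
      fin_cases i <;> rfl
    · by_cases hj : j = i
      · exact .inl (hj ▸ hκ)
      · refine .inr ?_
        rw [hcoord, hξ, Pi.single_eq_of_ne]
        simpa using hj
  simpa [hξ₀] using congrFun hξ i.castSucc

theorem isBiholomorphicNear_quadric {κ : Fin 2 → ℝ} (hLevi : IsLeviNondegenerate M) (hp : p ∈ M)
    (hf : AnalyticAt ℂ f p) (hbij : Function.Bijective (fderiv ℂ f p))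
    (hM : ∀ᶠ q in 𝓝 p, q ∈ M ↔ (f q 2).im = ∑ i, κ i * ‖f q i.castSucc‖ ^ 2) :
    IsBiholomorphicNear M (quadric 1) p ∨ IsBiholomorphicNear M (quadric (-1)) p := by
  obtain ⟨ε, hε, A, hA⟩ := exists_linear_quadric_iff (coefficient_ne_zero hLevi hp hf hbij hM)
  have hquadric : IsBiholomorphicNear M (quadric ε) p :=
    isBiholomorphicNear_of_linear A hf hbij (hM.mono fun q hq => hq.trans (hA (f q)))
  rcases hε with rfl | rfl
  exacts [.inl hquadric, .inr hquadric]

theorem isBiholomorphicNear_of_coordinates {z₀ z₁ w : C3 → ℂ} {κ₀ κ₁ : ℝ}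
    (hLevi : IsLeviNondegenerate M) (hp : p ∈ M) (hz₀ : AnalyticAt ℂ z₀ p)
    (hz₁ : AnalyticAt ℂ z₁ p) (hw : AnalyticAt ℂ w p) (X : Fin 3 → C3)
    (hdet : (Matrix.of fun i =>
      ![fderiv ℂ z₀ p (X i), fderiv ℂ z₁ p (X i), fderiv ℂ w p (X i)]).det ≠ 0)
    (hM : ∀ᶠ q in 𝓝 p, q ∈ M ↔ (w q).im = κ₀ * ‖z₀ q‖ ^ 2 + κ₁ * ‖z₁ q‖ ^ 2) :
    IsBiholomorphicNear M (quadric 1) p ∨ IsBiholomorphicNear M (quadric (-1)) p := by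
  have hf : AnalyticAt ℂ (fun q => ![z₀ q, z₁ q, w q]) p := by
    refine analyticAt_pi_iff.2 fun i => ?_
    fin_cases i
    exacts [hz₀, hz₁, hw]
  have hfderiv (v : C3) : fderiv ℂ (fun q => ![z₀ q, z₁ q, w q]) p v =
      ![fderiv ℂ z₀ p v, fderiv ℂ z₁ p v, fderiv ℂ w p v] := by
    ext i
    rw [← fderiv_coord_apply hf.differentiableAt]
    fin_cases i <;> rfl
  refine isBiholomorphicNear_quadric (κ := ![κ₀, κ₁]) hLevi hp hf ?_ ?_
  · exact bijective_of_det_ne_zero (fderiv ℂ (fun q => ![z₀ q, z₁ q, w q]) p : C3 →ₗ[ℂ] C3) X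
      (by simpa only [ContinuousLinearMap.coe_coe, hfderiv] using hdet)
  · simpa [Fin.sum_univ_two] using hM

end Charts

section Discs

open ComplexConjugate

theorem eventually_eq_of_isLocalMax_re {f : ℂ → ℂ} {c : ℂ}
    (hf : ∀ᶠ t in 𝓝 c, DifferentiableAt ℂ f t) (hmax : IsLocalMax (fun t => (f t).re) c) :
    ∀ᶠ t in 𝓝 c, f t = f c := by
  have hexp : ∀ᶠ t in 𝓝 c, Complex.exp (f t - f c) = Complex.exp (f c - f c) := by
    refine Complex.eventually_eq_of_isLocalMax_norm (f := fun t => Complex.exp (f t - f c))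
      (hf.mono fun t ht => (ht.sub_const _).cexp) (hmax.mono fun t ht => ?_)
    simpa only [Function.comp_apply, Complex.norm_exp, Real.exp_le_exp, Complex.sub_re,
      sub_le_sub_iff_right] using ht
  have hsmall : ∀ᶠ t in 𝓝 c, |(f t - f c).im| < Real.pi := by
    have hcont : ContinuousAt (fun t => |(f t - f c).im|) c :=
      (Complex.continuous_im.continuousAt.comp
        (hf.self_of_nhds.continuousAt.sub continuousAt_const)).abs
    exact hcont.eventually_lt_const (by simpa using Real.pi_pos)
  filter_upwards [hexp, hsmall] with t ht htπ
  rw [sub_self, Complex.exp_zero] at ht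
  rw [← sub_eq_zero, ← Complex.log_exp (abs_lt.1 htπ).1 (abs_lt.1 htπ).2.le, ht, Complex.log_one]

/-- With `(c₀, c₁, c₂) = ψ 0`, polarization shows that `|ψ₀ - c₀|² + |ψ₁ - c₁|²` is minus the real
part of a holomorphic function of the parameter. -/
theorem eventually_eq_of_mem_quadric_one {ψ : ℂ → C3} (hψ : ∀ᶠ t in 𝓝 0, DifferentiableAt ℂ ψ t)
    (hQ : ∀ᶠ t in 𝓝 0, ψ t ∈ quadric 1) : ∀ᶠ t in 𝓝 0, ψ t = ψ 0 := by
  let H : ℂ → ℂ := fun t => Complex.I * ψ t 2 + 2 * (conj (ψ 0 0) * ψ t 0 + conj (ψ 0 1) * ψ t 1)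
  have hH : ∀ᶠ t in 𝓝 0, DifferentiableAt ℂ H t := by
    filter_upwards [hψ] with t ht
    have := differentiableAt_pi.1 ht
    fun_prop
  have hre : ∀ᶠ t in 𝓝 0,
      (H 0).re - (H t).re = ‖ψ t 0 - ψ 0 0‖ ^ 2 + ‖ψ t 1 - ψ 0 1‖ ^ 2 := by
    filter_upwards [hQ] with t ht
    have h0 := hQ.self_of_nhds
    simp only [quadric, Set.mem_ofPred_eq, Complex.sq_norm, Complex.normSq_apply] at ht h0
    simp [H, Complex.sq_norm, Complex.normSq_apply, ht, h0]
    ring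
  have hconst : ∀ᶠ t in 𝓝 0, H t = H 0 := by
    refine eventually_eq_of_isLocalMax_re hH (hre.mono fun t ht => ?_)
    exact sub_nonneg.1 (ht.symm ▸ by positivity)
  filter_upwards [hconst, hre] with t ht htre
  rw [ht, sub_self, eq_comm, add_eq_zero_iff_of_nonneg (sq_nonneg _) (sq_nonneg _)] at htre
  obtain ⟨h₀, h₁⟩ : ψ t 0 = ψ 0 0 ∧ ψ t 1 = ψ 0 1 := by
    simpa [sub_eq_zero] using htre
  have h₂ : ψ t 2 = ψ 0 2 := by
    simpa [H, h₀, h₁] using ht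
  funext i
  fin_cases i
  exacts [h₀, h₁, h₂]

theorem add_smul_mem_quadric_neg_one {P : C3} (hP : P ∈ quadric (-1)) (t : ℂ) :
    P + t • ![1, 1, 2 * Complex.I * (conj (P 0) - conj (P 1))] ∈ quadric (-1) := by
  simp only [quadric, Set.mem_ofPred_eq, Complex.sq_norm, Complex.normSq_apply] at hP ⊢
  simp [hP]
  ring

theorem not_isBiholomorphicNear_both {M : Set C3} {p : C3} (hp : p ∈ M)
    (h₁ : IsBiholomorphicNear M (quadric 1) p) (h₂ : IsBiholomorphicNear M (quadric (-1)) p) :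
    False := by
  obtain ⟨F, hpF, hF, -, hFM⟩ := h₁
  obtain ⟨G, hpG, -, hGsymm, hGM⟩ := h₂
  let φ : ℂ → C3 := fun t => G p + t • ![1, 1, 2 * Complex.I * (conj (G p 0) - conj (G p 1))]
  have hφ₀ : φ 0 = G p := by simp only [φ, zero_smul, add_zero]
  have hφ (t : ℂ) : DifferentiableAt ℂ φ t := by fun_prop
  have hφQ (t : ℂ) : φ t ∈ quadric (-1) := add_smul_mem_quadric_neg_one ((hGM hpG).2 hp) t
  have hGtarget : ∀ᶠ t : ℂ in 𝓝 0, φ t ∈ G.target :=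
    (hφ 0).continuousAt (by rw [hφ₀]; exact G.open_target.mem_nhds (G.map_source hpG))
  have hFsource : ∀ᶠ t : ℂ in 𝓝 0, G.symm (φ t) ∈ F.source := by
    have hcont : ContinuousAt (G.symm ∘ φ) 0 :=
      ContinuousAt.comp (by rw [hφ₀]; exact G.continuousAt_symm (G.map_source hpG))
        (hφ 0).continuousAt
    exact hcont (F.open_source.mem_nhds (by simpa [hφ₀, G.left_inv hpG] using hpF))
  have hconst : ∀ᶠ t in 𝓝 0, F (G.symm (φ t)) = F (G.symm (φ 0)) := by
    refine eventually_eq_of_mem_quadric_one (ψ := fun t => F (G.symm (φ t))) ?_ ?_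
    · filter_upwards [hGtarget, hFsource] with t hGt hFt
      exact (hF.differentiableAt (F.open_source.mem_nhds hFt)).comp t
        ((hGsymm.differentiableAt (G.open_target.mem_nhds hGt)).comp t (hφ t))
    · filter_upwards [hGtarget, hFsource] with t hGt hFt
      exact (hFM hFt).2 ((hGM (G.map_target hGt)).1 (by rw [G.right_inv hGt]; exact hφQ t))
  have hφconst : ∀ᶠ t : ℂ in 𝓝 0, t = 0 := by
    filter_upwards [hconst, hGtarget, hFsource] with t ht hGt hFt
    have hφt := G.symm.injOn hGt hGtarget.self_of_nhds (F.injOn hFt hFsource.self_of_nhds ht)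
    simpa [φ] using congrFun hφt 0
  obtain ⟨t, ht, hne⟩ := ((hφconst.filter_mono nhdsWithin_le_nhds).and
    (self_mem_nhdsWithin : {0}ᶜ ∈ 𝓝[≠] (0 : ℂ))).exists
  exact hne ht

theorem isSpherical_of_isBiholomorphicNear {M : Set C3} (hM : IsConnected M)
    (h : ∀ p ∈ M, IsBiholomorphicNear M (quadric 1) p ∨ IsBiholomorphicNear M (quadric (-1)) p) :
    IsSpherical M := by
  have hopen (Q : Set C3) : IsOpen {p | IsBiholomorphicNear M Q p} := by
    refine isOpen_iff_mem_nhds.2 ?_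
    rintro p ⟨F, hp, hF⟩
    filter_upwards [F.open_source.mem_nhds hp] with q hq using ⟨F, hq, hF⟩
  by_contra hnot
  obtain ⟨⟨p, hp, hp₁⟩, q, hq, hq₂⟩ : (∃ p ∈ M, ¬ IsBiholomorphicNear M (quadric 1) p) ∧
      ∃ p ∈ M, ¬ IsBiholomorphicNear M (quadric (-1)) p := by
    simpa [IsSpherical, IsLocallyBiholomorphicTo, IsBiholomorphicNear] using hnot
  obtain ⟨x, hx, hx₁, hx₂⟩ := hM.isPreconnected _ _ (hopen (quadric 1)) (hopen (quadric (-1))) h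
    ⟨q, hq, (h q hq).resolve_right hq₂⟩ ⟨p, hp, (h p hp).resolve_left hp₁⟩
  exact not_isBiholomorphicNear_both hx hx₁ hx₂

end Discs

section Coframes

theorem eq_mul_exp_of_hasFDerivAt {E : Type*} [NormedAddCommGroup E] [NormedSpace ℂ E] {V : Set E}
    {f τ : E → ℂ} {τ' : E → E →L[ℂ] ℂ} {ν : ℂ} (hV : IsOpen V) (hV' : IsPreconnected V)
    (hτ : ∀ q ∈ V, HasFDerivAt τ (τ' q) q) (hf : ∀ q ∈ V, HasFDerivAt f ((ν * f q) • τ' q) q)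
    {p q : E} (hp : p ∈ V) (hq : q ∈ V) : f q = f p * Complex.exp (ν * (τ q - τ p)) := by
  have hconst : ∀ q ∈ V, HasFDerivAt (fun q => f q * Complex.exp (-ν * τ q)) (0 : E →L[ℂ] ℂ) q :=
    fun q hq => by
      refine ((hf q hq).mul ((hτ q hq).const_mul (-ν)).cexp).congr_fderiv ?_
      ext v
      simp only [add_apply, smul_apply, smul_eq_mul, zero_apply]
      ring
  have heq : f q * Complex.exp (-ν * τ q) = f p * Complex.exp (-ν * τ p) :=
    hV.is_const_of_fderiv_eq_zero hV'
      (fun q hq => (hconst q hq).differentiableAt.differentiableWithinAt)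
      (fun q hq => (hconst q hq).fderiv) hq hp
  calc f q = f q * Complex.exp (-ν * τ q) * Complex.exp (ν * τ q) := by
        rw [mul_assoc, ← Complex.exp_add]; simp
    _ = f p * Complex.exp (ν * (τ q - τ p)) := by
        rw [heq, mul_assoc, ← Complex.exp_add]; ring_nf

variable {E : Type*} [NormedAddCommGroup E] [NormedSpace ℂ E] {ι : Type*} [Fintype ι]
  [DecidableEq ι] {V : Set E} {X : ι → E → E} {θ : E → E →L[ℂ] ι → ℂ}

open VectorField (lieBracket)

/-- `X` is a holomorphic frame on the open set `V`, with dual coframe `θ`: the components of `θ q v`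
are the coefficients of the vector `v` at `q` with respect to the frame. -/
structure IsCoframe (V : Set E) (X : ι → E → E) (θ : E → E →L[ℂ] ι → ℂ) : Prop where
  isOpen : IsOpen V
  differentiableOn_frame : ∀ i, DifferentiableOn ℂ (X i) V
  differentiableOn : DifferentiableOn ℂ θ V
  apply_frame : ∀ q ∈ V, ∀ i, θ q (X i q) = Pi.single i 1
  sum_smul : ∀ q ∈ V, ∀ v, ∑ i, θ q v i • X i q = v

theorem exists_isCoframe [FiniteDimensional ℂ E] {U : Set E} {p : E} (hU : U ∈ 𝓝 p)
    (hX : ∀ i, DifferentiableOn ℂ (X i) U) (hind : LinearIndependent ℂ fun i => X i p)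
    (hcard : Fintype.card ι = Module.finrank ℂ E) :
    ∃ r > 0, Metric.ball p r ⊆ U ∧ ∃ θ, IsCoframe (Metric.ball p r) X θ := by
  have : CompleteSpace E := FiniteDimensional.complete ℂ E
  let frame (q : E) : (ι → ℂ) →L[ℂ] E :=
    ∑ i, (ContinuousLinearMap.proj i : (ι → ℂ) →L[ℂ] ℂ).smulRight (X i q)
  have frame_apply (q : E) (c : ι → ℂ) : frame q c = ∑ i, c i • X i q := by
    simp [frame, sum_apply]
  have hframe : DifferentiableOn ℂ frame U :=
    DifferentiableOn.fun_sum fun i _ =>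
      (ContinuousLinearMap.smulRightL ℂ (ι → ℂ) E
        (ContinuousLinearMap.proj i)).differentiable.comp_differentiableOn (hX i)
  obtain ⟨e, he⟩ : ∃ e : (ι → ℂ) ≃L[ℂ] E, (e : (ι → ℂ) →L[ℂ] E) = frame p := by
    let basis := basisOfLinearIndependentOfCardEqFinrank' _ hind hcard
    refine ⟨basis.equivFun.symm.toContinuousLinearEquiv, ContinuousLinearMap.ext fun c => ?_⟩
    change basis.equivFun.symm c = frame p c
    rw [basis.equivFun_symm_apply, frame_apply]
    simp [basis]
  have hnhds : ∀ᶠ q in 𝓝 p, q ∈ U ∧ frame q ∈ Set.range ((↑) : ((ι → ℂ) ≃L[ℂ] E) → _) :=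
    Filter.inter_mem hU ((hframe.differentiableAt hU).continuousAt (he ▸ e.nhds))
  obtain ⟨r, hr, hball⟩ := Metric.mem_nhds_iff.1 hnhds
  refine ⟨r, hr, fun q hq => (hball hq).1, fun q => (frame q).inverse, Metric.isOpen_ball,
    fun i => (hX i).mono fun q hq => (hball hq).1, fun q hq => ?_, fun q hq i => ?_,
    fun q hq v => ?_⟩
  all_goals obtain ⟨-, e', he'⟩ := hball hq
  · have hinverse := (contDiffAt_map_inverse (𝕜 := ℂ) (n := 1) e').differentiableAt one_ne_zero
    rw [he'] at hinverse
    have hUq : U ∈ 𝓝 q :=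
      Filter.mem_of_superset (Metric.isOpen_ball.mem_nhds hq) fun y hy => (hball hy).1
    exact (hinverse.comp q (hframe.differentiableAt hUq)).differentiableWithinAt
  · rw [← he', ContinuousLinearMap.inverse_equiv, ContinuousLinearEquiv.coe_coe,
      ContinuousLinearEquiv.symm_apply_eq, ← ContinuousLinearEquiv.coe_coe, he', frame_apply]
    simp [Pi.single_apply]
  · rw [← frame_apply, ← he', ContinuousLinearMap.inverse_equiv]
    exact e'.apply_symm_apply v

theorem exists_isCoframe_of_linearIndependent {U : Set C3} {X Y Z : C3 → C3} {p : C3}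
    (hU : U ∈ 𝓝 p)
    (hX : DifferentiableOn ℂ X U) (hY : DifferentiableOn ℂ Y U) (hZ : DifferentiableOn ℂ Z U)
    (hind : LinearIndependent ℂ ![X p, Y p, Z p]) :
    ∃ r > 0, Metric.ball p r ⊆ U ∧ ∃ θ, IsCoframe (Metric.ball p r) ![X, Y, Z] θ := by
  have hframe : (fun i => ![X, Y, Z] i p) = ![X p, Y p, Z p] := by
    ext i; fin_cases i <;> rfl
  exact exists_isCoframe hU (by simp [Fin.forall_fin_succ, hX, hY, hZ]) (hframe ▸ hind) (by simp)

namespace IsCoframe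

theorem clm_apply {F : Type*} [NormedAddCommGroup F] [NormedSpace ℂ F] (h : IsCoframe V X θ)
    {q : E} (hq : q ∈ V) (l : E →L[ℂ] F) (v : E) : l v = ∑ i, θ q v i • l (X i q) := by
  conv_lhs => rw [← h.sum_smul q hq v]
  simp only [map_sum, map_smul]

theorem fderiv_apply_frame (h : IsCoframe V X θ) {q : E} (hq : q ∈ V) (v : E) (i : ι) :
    fderiv ℂ θ q v (X i q) = -θ q (fderiv ℂ (X i) q v) := by
  have hV := h.isOpen.mem_nhds hq
  have hconst : (fun q => θ q (X i q)) =ᶠ[𝓝 q] fun _ => Pi.single i 1 := by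
    filter_upwards [hV] with q' hq' using h.apply_frame q' hq' i
  have hderiv := ((h.differentiableOn.differentiableAt hV).hasFDerivAt.clm_apply
    ((h.differentiableOn_frame i).differentiableAt hV).hasFDerivAt).unique
    ((hasFDerivAt_const _ q).congr_of_eventuallyEq hconst)
  exact eq_neg_of_add_eq_zero_right (by simpa using DFunLike.congr_fun hderiv v)

theorem differentiableAt_coeff (h : IsCoframe V X θ) {W : E → E} {q : E} (hq : q ∈ V)
    (hW : DifferentiableAt ℂ W q) (k : ι) : DifferentiableAt ℂ (fun q => θ q (W q) k) q :=
  differentiableAt_pi.1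
    ((h.differentiableOn.differentiableAt (h.isOpen.mem_nhds hq)).clm_apply hW) k

theorem fderiv_coeff (h : IsCoframe V X θ) {T W : E → E} {q : E} (hq : q ∈ V)
    (hW : DifferentiableAt ℂ W q) (k : ι) :
    fderiv ℂ (fun q => θ q (W q) k) q (T q) =
      θ q (lieBracket ℂ T W q) k - ∑ j, θ q (W q) j * θ q (lieBracket ℂ T (X j) q) k := by
  have hθ := h.differentiableOn.differentiableAt (h.isOpen.mem_nhds hq)
  have hθW : fderiv ℂ θ q (T q) (W q) = -∑ j, θ q (W q) j • θ q (fderiv ℂ (X j) q (T q)) := by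
    rw [h.clm_apply hq (fderiv ℂ θ q (T q)) (W q)]
    simp only [h.fderiv_apply_frame hq, smul_neg, Finset.sum_neg_distrib]
  have hT : θ q (fderiv ℂ T q (W q)) = ∑ j, θ q (W q) j • θ q (fderiv ℂ T q (X j q)) :=
    h.clm_apply hq ((θ q).comp (fderiv ℂ T q)) (W q)
  have hvector : fderiv ℂ (fun q => θ q (W q)) q (T q) =
      θ q (lieBracket ℂ T W q) - ∑ j, θ q (W q) j • θ q (lieBracket ℂ T (X j) q) := by
    rw [(hθ.hasFDerivAt.clm_apply hW.hasFDerivAt).fderiv]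
    simp only [lieBracket, map_sub, smul_sub, Finset.sum_sub_distrib, ← hT, add_apply,
      ContinuousLinearMap.comp_apply, ContinuousLinearMap.flip_apply, hθW]
    abel
  rw [(hasFDerivAt_pi'.1 (hθ.clm_apply hW).hasFDerivAt k).fderiv, ContinuousLinearMap.comp_apply,
    ContinuousLinearMap.proj_apply, hvector]
  simp only [Pi.sub_apply, Finset.sum_apply, Pi.smul_apply, smul_eq_mul]

theorem exists_primitive (h : IsCoframe V X θ) (hV : Convex ℝ V) {k : ι}
    (hk : ∀ q ∈ V, ∀ i j, θ q (lieBracket ℂ (X i) (X j) q) k = 0) :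
    ∃ τ : E → ℂ, ∀ q ∈ V,
      HasFDerivAt τ ((ContinuousLinearMap.proj k : (ι → ℂ) →L[ℂ] ℂ).comp (θ q)) q := by
  let ω (q : E) : E →L[ℂ] ℂ := (ContinuousLinearMap.proj k).comp (θ q)
  have hω : DifferentiableOn ℂ ω V :=
    (ContinuousLinearMap.compL ℂ E (ι → ℂ) ℂ
      (ContinuousLinearMap.proj k)).differentiable.comp_differentiableOn h.differentiableOn
  refine hV.exists_forall_hasFDerivAt_of_fderiv_symmetric h.isOpen (hω.restrictScalars ℝ)
    fun q hq u v => ?_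
  have hV := h.isOpen.mem_nhds hq
  have hθ := (h.differentiableOn.differentiableAt hV).hasFDerivAt
  have hfderiv (u v : E) : fderiv ℂ ω q u v = fderiv ℂ θ q u v k := by
    rw [((hasFDerivAt_const (ContinuousLinearMap.proj k) q).clm_comp hθ).fderiv]
    simp
  have hframe (i j : ι) : fderiv ℂ ω q (X i q) (X j q) = fderiv ℂ ω q (X j q) (X i q) := by
    rw [hfderiv, hfderiv, h.fderiv_apply_frame hq, h.fderiv_apply_frame hq, Pi.neg_apply,
      Pi.neg_apply, neg_inj, ← sub_eq_zero, ← Pi.sub_apply, ← map_sub]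
    exact hk q hq i j
  rw [(hω.differentiableAt hV).fderiv_restrictScalars ℝ]
  change fderiv ℂ ω q u v = fderiv ℂ ω q v u
  have hexpand (u v : E) : fderiv ℂ ω q u v =
      ∑ i, ∑ j, θ q u i * θ q v j * fderiv ℂ ω q (X i q) (X j q) := by
    rw [h.clm_apply hq (fderiv ℂ ω q) u]
    simp only [sum_apply, smul_apply, h.clm_apply hq (fderiv ℂ ω q (X _ q)) v, smul_eq_mul,
      Finset.mul_sum, mul_assoc]
  rw [hexpand, hexpand, Finset.sum_comm]
  simp only [hframe, mul_comm (θ q u _)]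

theorem coeff_eq_mul_exp (h : IsCoframe V X θ) (hV : IsPreconnected V) {k : ι} {τ : E → ℂ}
    (hk : ∀ q ∈ V, ∀ i j, θ q (lieBracket ℂ (X i) (X j) q) k = 0)
    (hτ : ∀ q ∈ V, HasFDerivAt τ ((ContinuousLinearMap.proj k : (ι → ℂ) →L[ℂ] ℂ).comp (θ q)) q)
    {W : E → E} (hW : DifferentiableOn ℂ W V) {ν : ℂ}
    (hne : ∀ q ∈ V, ∀ i ≠ k, θ q (lieBracket ℂ (X i) W q) k = 0)
    (heq : ∀ q ∈ V, θ q (lieBracket ℂ (X k) W q) k = ν * θ q (W q) k)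
    {p q : E} (hp : p ∈ V) (hq : q ∈ V) :
    θ q (W q) k = θ p (W p) k * Complex.exp (ν * (τ q - τ p)) := by
  refine eq_mul_exp_of_hasFDerivAt (f := fun q => θ q (W q) k) h.isOpen hV hτ
    (fun q hq => ?_) hp hq
  have hV := h.isOpen.mem_nhds hq
  have hWq := hW.differentiableAt hV
  refine (h.differentiableAt_coeff hq hWq k).hasFDerivAt.congr_fderiv
    (ContinuousLinearMap.ext fun v => ?_)
  have hframe (i : ι) : fderiv ℂ (fun q => θ q (W q) k) q (X i q) =
      θ q (lieBracket ℂ (X i) W q) k := by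
    simp only [h.fderiv_coeff hq hWq, hk q hq, mul_zero, Finset.sum_const_zero, sub_zero]
  rw [h.clm_apply hq _ v, Finset.sum_eq_single k (fun i _ hi => ?_) (by simp)]
  · simp only [hframe, heq q hq, ContinuousLinearMap.comp_apply, ContinuousLinearMap.proj_apply,
      smul_apply, smul_eq_mul]
    ring
  · rw [hframe, hne q hq i hi, smul_zero]

theorem coeff_zero_of_mem_span {V : Set E} {X Y Z : E → E} {θ : E → E →L[ℂ] Fin 3 → ℂ} {p : E}
    (h : IsCoframe V ![X, Y, Z] θ) (hp : p ∈ V) {v : E} (hv : v ∈ Submodule.span ℂ {Y p, Z p}) :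
    θ p v 0 = 0 := by
  obtain ⟨y, z, rfl⟩ := Submodule.mem_span_pair.1 hv
  have hY : θ p (Y p) = Pi.single 1 1 := h.apply_frame p hp 1
  have hZ : θ p (Z p) = Pi.single 2 1 := h.apply_frame p hp 2
  simp [hY, hZ]

end IsCoframe

end Coframes

section FieldTuples

open VectorField (lieBracket lieBracket_self lieBracket_swap)

/-- Five vector fields on `ℂ³`. For a realization of `𝔤_{5,37}` they are the images of
`e₁`, `e₂ + i e₃`, `e₂ - i e₃`, `e₄`, `e₅`, which diagonalize the action of `e₄` and `e₅`. -/
structure FieldTuple where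
  (e₁ a b e₄ e₅ : C3 → C3)

namespace FieldTuple

/-- The fields are holomorphic on the open set `U` and satisfy the bracket relations of the
complexification of `𝔤_{5,37}`. -/
structure IsRealization (F : FieldTuple) (U : Set C3) : Prop where
  isOpen : IsOpen U
  diff₁ : DifferentiableOn ℂ F.e₁ U
  diffa : DifferentiableOn ℂ F.a U
  diffb : DifferentiableOn ℂ F.b U
  diff₄ : DifferentiableOn ℂ F.e₄ U
  diff₅ : DifferentiableOn ℂ F.e₅ U
  lie_1a : ∀ q ∈ U, lieBracket ℂ F.e₁ F.a q = 0
  lie_1b : ∀ q ∈ U, lieBracket ℂ F.e₁ F.b q = 0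
  lie_14 : ∀ q ∈ U, lieBracket ℂ F.e₁ F.e₄ q = (2 : ℂ) • F.e₁ q
  lie_15 : ∀ q ∈ U, lieBracket ℂ F.e₁ F.e₅ q = 0
  lie_ab : ∀ q ∈ U, lieBracket ℂ F.a F.b q = (-2 * Complex.I) • F.e₁ q
  lie_a4 : ∀ q ∈ U, lieBracket ℂ F.a F.e₄ q = F.a q
  lie_a5 : ∀ q ∈ U, lieBracket ℂ F.a F.e₅ q = Complex.I • F.a q
  lie_b4 : ∀ q ∈ U, lieBracket ℂ F.b F.e₄ q = F.b q
  lie_b5 : ∀ q ∈ U, lieBracket ℂ F.b F.e₅ q = (-Complex.I) • F.b q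
  lie_45 : ∀ q ∈ U, lieBracket ℂ F.e₄ F.e₅ q = 0

/-- `f` is complex differentiable at `q`, with the prescribed derivatives along the five fields. -/
structure HasDerivs (F : FieldTuple) (f : C3 → ℂ) (q : C3) (c₁ ca cb c₄ c₅ : ℂ) : Prop where
  differentiableAt : DifferentiableAt ℂ f q
  along_e₁ : fderiv ℂ f q (F.e₁ q) = c₁
  along_a : fderiv ℂ f q (F.a q) = ca
  along_b : fderiv ℂ f q (F.b q) = cb
  along_e₄ : fderiv ℂ f q (F.e₄ q) = c₄
  along_e₅ : fderiv ℂ f q (F.e₅ q) = c₅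

variable {F : FieldTuple} {U : Set C3} {p q : C3}

namespace IsRealization

theorem lie_a1 (h : F.IsRealization U) (hq : q ∈ U) : lieBracket ℂ F.a F.e₁ q = 0 := by
  rw [lieBracket_swap, h.lie_1a q hq, neg_zero]

theorem lie_b1 (h : F.IsRealization U) (hq : q ∈ U) : lieBracket ℂ F.b F.e₁ q = 0 := by
  rw [lieBracket_swap, h.lie_1b q hq, neg_zero]

theorem lie_ba (h : F.IsRealization U) (hq : q ∈ U) :
    lieBracket ℂ F.b F.a q = (2 * Complex.I) • F.e₁ q := by
  rw [lieBracket_swap, h.lie_ab q hq, neg_mul, neg_smul, neg_neg]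

theorem lie_41 (h : F.IsRealization U) (hq : q ∈ U) :
    lieBracket ℂ F.e₄ F.e₁ q = (-2 : ℂ) • F.e₁ q := by
  rw [lieBracket_swap, h.lie_14 q hq, neg_smul]

theorem lie_4a (h : F.IsRealization U) (hq : q ∈ U) : lieBracket ℂ F.e₄ F.a q = -F.a q := by
  rw [lieBracket_swap, h.lie_a4 q hq]

theorem lie_4b (h : F.IsRealization U) (hq : q ∈ U) : lieBracket ℂ F.e₄ F.b q = -F.b q := by
  rw [lieBracket_swap, h.lie_b4 q hq]

theorem lie_51 (h : F.IsRealization U) (hq : q ∈ U) : lieBracket ℂ F.e₅ F.e₁ q = 0 := by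
  rw [lieBracket_swap, h.lie_15 q hq, neg_zero]

theorem lie_5a (h : F.IsRealization U) (hq : q ∈ U) :
    lieBracket ℂ F.e₅ F.a q = (-Complex.I) • F.a q := by
  rw [lieBracket_swap, h.lie_a5 q hq, neg_smul]

theorem lie_5b (h : F.IsRealization U) (hq : q ∈ U) :
    lieBracket ℂ F.e₅ F.b q = Complex.I • F.b q := by
  rw [lieBracket_swap, h.lie_b5 q hq, neg_smul, neg_neg]

theorem lie_54 (h : F.IsRealization U) (hq : q ∈ U) : lieBracket ℂ F.e₅ F.e₄ q = 0 := by
  rw [lieBracket_swap, h.lie_45 q hq, neg_zero]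

theorem exists_coordinates_of_free (h : F.IsRealization U) (hp : p ∈ U)
    (hind : LinearIndependent ℂ ![F.a p, F.e₁ p, F.b p]) :
    ∃ x y u : C3 → ℂ, ∀ᶠ q in 𝓝 p,
      F.HasDerivs x q 0 1 0 (x q) (Complex.I * x q) ∧
      F.HasDerivs y q 0 0 1 (y q) (-(Complex.I * y q)) ∧
      F.HasDerivs u q 2 (2 * Complex.I * y q) (-(2 * Complex.I * x q)) (2 * u q) 0 := by
  obtain ⟨r, hr, hrU, θ, hθ⟩ :=
    exists_isCoframe_of_linearIndependent (h.isOpen.mem_nhds hp) h.diffa h.diff₁ h.diffb hind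
  refine ⟨fun q => θ q (F.e₄ q) 0, fun q => θ q (F.e₄ q) 2, fun q => θ q (F.e₄ q) 1, ?_⟩
  filter_upwards [Metric.ball_mem_nhds p hr] with q hq
  have hqU := hrU hq
  have hdiff := h.diff₄.differentiableAt (h.isOpen.mem_nhds hqU)
  have hθa : θ q (F.a q) = Pi.single 0 1 := hθ.apply_frame q hq 0
  have hθ₁ : θ q (F.e₁ q) = Pi.single 1 1 := hθ.apply_frame q hq 1
  have hθb : θ q (F.b q) = Pi.single 2 1 := hθ.apply_frame q hq 2
  refine ⟨⟨hθ.differentiableAt_coeff hq hdiff 0, ?_, ?_, ?_, ?_, ?_⟩,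
    ⟨hθ.differentiableAt_coeff hq hdiff 2, ?_, ?_, ?_, ?_, ?_⟩,
    ⟨hθ.differentiableAt_coeff hq hdiff 1, ?_, ?_, ?_, ?_, ?_⟩⟩ <;>
  · rw [hθ.fderiv_coeff hq hdiff]
    simp [Fin.sum_univ_three, h.lie_14 q hqU, h.lie_1a q hqU, h.lie_1b q hqU,
      h.lie_a4 q hqU, h.lie_ab q hqU, h.lie_a1 hqU, h.lie_b4 q hqU, h.lie_b1 hqU, h.lie_ba hqU,
      h.lie_41 hqU, h.lie_4a hqU, h.lie_4b hqU, h.lie_54 hqU, h.lie_51 hqU, h.lie_5a hqU,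
      h.lie_5b hqU, hθa, hθb, hθ₁, lieBracket_self, mul_comm]

section TransversalFour

variable {V : Set C3} {θ : C3 → C3 →L[ℂ] C3} {τ : C3 → ℂ}

theorem coeff_lieBracket_transversal_four (h : F.IsRealization U) (hVU : V ⊆ U)
    (hθ : IsCoframe V ![F.e₄, F.e₁, F.b] θ) (hq : q ∈ V) (i j : Fin 3) :
    θ q (lieBracket ℂ (![F.e₄, F.e₁, F.b] i) (![F.e₄, F.e₁, F.b] j) q) 0 = 0 := by
  have hqU := hVU hq
  have hθ₁ : θ q (F.e₁ q) = Pi.single 1 1 := hθ.apply_frame q hq 1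
  have hθb : θ q (F.b q) = Pi.single 2 1 := hθ.apply_frame q hq 2
  fin_cases i <;> fin_cases j <;>
    simp [h.lie_41 hqU, h.lie_4b hqU, h.lie_14 q hqU, h.lie_b4 q hqU, h.lie_1b q hqU,
      h.lie_b1 hqU, hθ₁, hθb, lieBracket_self]

theorem coeff_a_zero_eq_zero (h : F.IsRealization U) (hVU : V ⊆ U) (hV : IsPreconnected V)
    (hθ : IsCoframe V ![F.e₄, F.e₁, F.b] θ)
    (hτ : ∀ q ∈ V, HasFDerivAt τ ((ContinuousLinearMap.proj 0 : C3 →L[ℂ] ℂ).comp (θ q)) q)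
    (hp : p ∈ V) (hap : θ p (F.a p) 0 = 0) (hq : q ∈ V) : θ q (F.a q) 0 = 0 := by
  have hθ₁ {q} (hq : q ∈ V) : θ q (F.e₁ q) = Pi.single 1 1 := hθ.apply_frame q hq 1
  rw [hθ.coeff_eq_mul_exp hV (fun q => h.coeff_lieBracket_transversal_four hVU hθ) hτ
    (h.diffa.mono hVU) (ν := -1) (fun q hq i hi => ?_) (fun q hq => ?_) hp hq, hap, zero_mul]
  · fin_cases i <;> simp_all [h.lie_1a q (hVU hq), h.lie_ba (hVU hq)]
  · simp [h.lie_4a (hVU hq)]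

theorem coeff_e₅_zero_eq (h : F.IsRealization U) (hVU : V ⊆ U) (hV : IsPreconnected V)
    (hθ : IsCoframe V ![F.e₄, F.e₁, F.b] θ)
    (hτ : ∀ q ∈ V, HasFDerivAt τ ((ContinuousLinearMap.proj 0 : C3 →L[ℂ] ℂ).comp (θ q)) q)
    (hp : p ∈ V) (hq : q ∈ V) : θ q (F.e₅ q) 0 = θ p (F.e₅ p) 0 := by
  have hθb {q} (hq : q ∈ V) : θ q (F.b q) = Pi.single 2 1 := hθ.apply_frame q hq 2
  rw [hθ.coeff_eq_mul_exp hV (fun q => h.coeff_lieBracket_transversal_four hVU hθ) hτ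
    (h.diff₅.mono hVU) (ν := 0) (fun q hq i hi => ?_) (fun q hq => ?_) hp hq, zero_mul,
    Complex.exp_zero, mul_one]
  · fin_cases i <;> simp_all [h.lie_15 q (hVU hq), h.lie_b5 q (hVU hq)]
  · simp [h.lie_45 q (hVU hq)]

-- The derivatives of the `b`-component along the frame vanish, whereas `[e₅, a] = -i a` and
-- `[e₅, b] = i b` make its derivative along `e₅` equal to `-2i` times the component itself.
theorem coeff_a_two_eq_zero (h : F.IsRealization U) (hVU : V ⊆ U)
    (hθ : IsCoframe V ![F.e₄, F.e₁, F.b] θ) (hq : q ∈ V) (ha : θ q (F.a q) 0 = 0) :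
    θ q (F.a q) 2 = 0 := by
  have hqU := hVU hq
  have hcoeff (T : C3 → C3) := hθ.fderiv_coeff (T := T) hq
    (h.diffa.differentiableAt (h.isOpen.mem_nhds hqU)) 2
  have hθ₁ : θ q (F.e₁ q) = Pi.single 1 1 := hθ.apply_frame q hq 1
  have hθb : θ q (F.b q) = Pi.single 2 1 := hθ.apply_frame q hq 2
  have hframe (i : Fin 3) :
      fderiv ℂ (fun q => θ q (F.a q) 2) q (![F.e₄, F.e₁, F.b] i q) = 0 := by
    rw [hcoeff]
    fin_cases i <;>
      simp [Fin.sum_univ_three, h.lie_4a hqU, h.lie_41 hqU, h.lie_4b hqU, h.lie_1a q hqU,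
        h.lie_14 q hqU, h.lie_1b q hqU, h.lie_ba hqU, h.lie_b4 q hqU, h.lie_b1 hqU, hθ₁, hθb,
        lieBracket_self, ha]
  have hzero : fderiv ℂ (fun q => θ q (F.a q) 2) q (F.e₅ q) = 0 := by
    rw [hθ.clm_apply hq]
    simp only [hframe, smul_zero, Finset.sum_const_zero]
  have hself : fderiv ℂ (fun q => θ q (F.a q) 2) q (F.e₅ q) =
      -2 * Complex.I * θ q (F.a q) 2 := by
    rw [hcoeff]
    simp only [h.lie_5a hqU, Fin.sum_univ_three, Matrix.cons_val_zero, Matrix.cons_val_one,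
      Matrix.cons_val, h.lie_54 hqU, h.lie_51 hqU, h.lie_5b hqU, map_smul, map_zero, hθb,
      Pi.smul_apply, Pi.zero_apply, Pi.single_eq_same, smul_eq_mul]
    ring
  simpa [Complex.I_ne_zero] using hself.symm.trans hzero

theorem a_eq_smul_e₁ (h : F.IsRealization U) (hVU : V ⊆ U)
    (hθ : IsCoframe V ![F.e₄, F.e₁, F.b] θ) (hq : q ∈ V) (ha : θ q (F.a q) 0 = 0) :
    F.a q = θ q (F.a q) 1 • F.e₁ q := by
  conv_lhs => rw [← hθ.sum_smul q hq (F.a q)]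
  simp [Fin.sum_univ_three, ha, h.coeff_a_two_eq_zero hVU hθ hq ha]

theorem hasDerivs_coeff_a (h : F.IsRealization U) (hVU : V ⊆ U)
    (hθ : IsCoframe V ![F.e₄, F.e₁, F.b] θ) (hq : q ∈ V) (ha : θ q (F.a q) 0 = 0) :
    F.HasDerivs (fun q => θ q (F.a q) 1) q 0 0 (2 * Complex.I) (θ q (F.a q) 1)
      (-(Complex.I * θ q (F.a q) 1)) := by
  have hqU := hVU hq
  have hdiff := h.diffa.differentiableAt (h.isOpen.mem_nhds hqU)
  have hθ₁ : θ q (F.e₁ q) = Pi.single 1 1 := hθ.apply_frame q hq 1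
  have hθb : θ q (F.b q) = Pi.single 2 1 := hθ.apply_frame q hq 2
  have h₁ : fderiv ℂ (fun q => θ q (F.a q) 1) q (F.e₁ q) = 0 := by
    rw [hθ.fderiv_coeff hq hdiff]
    simp [Fin.sum_univ_three, h.lie_1a q hqU, h.lie_1b q hqU, h.lie_14 q hqU, lieBracket_self, ha]
  refine ⟨hθ.differentiableAt_coeff hq hdiff 1, h₁, ?_, ?_, ?_, ?_⟩
  · conv_lhs => rw [h.a_eq_smul_e₁ hVU hθ hq ha]
    rw [map_smul, h₁, smul_zero]
  all_goals
    rw [hθ.fderiv_coeff hq hdiff]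
    simp [Fin.sum_univ_three, h.lie_ba hqU, h.lie_b4 q hqU, h.lie_b1 hqU, h.lie_4a hqU,
      h.lie_41 hqU, h.lie_4b hqU, h.lie_5a hqU, h.lie_54 hqU, h.lie_51 hqU, h.lie_5b hqU,
      lieBracket_self, ha, h.coeff_a_two_eq_zero hVU hθ hq ha, hθ₁, hθb]
  ring

theorem hasDerivs_coeff_e₅ (h : F.IsRealization U) (hVU : V ⊆ U)
    (hθ : IsCoframe V ![F.e₄, F.e₁, F.b] θ) (hq : q ∈ V) (ha : θ q (F.a q) 0 = 0) :
    F.HasDerivs (fun q => θ q (F.e₅ q) 1) q (-(2 * θ q (F.e₅ q) 0))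
      (-(2 * θ q (F.e₅ q) 0 * θ q (F.a q) 1)) 0 (2 * θ q (F.e₅ q) 1) 0 := by
  have hqU := hVU hq
  have hdiff := h.diff₅.differentiableAt (h.isOpen.mem_nhds hqU)
  have hθ₁ : θ q (F.e₁ q) = Pi.single 1 1 := hθ.apply_frame q hq 1
  have hθb : θ q (F.b q) = Pi.single 2 1 := hθ.apply_frame q hq 2
  have h₁ : fderiv ℂ (fun q => θ q (F.e₅ q) 1) q (F.e₁ q) = -(2 * θ q (F.e₅ q) 0) := by
    rw [hθ.fderiv_coeff hq hdiff]
    simp [Fin.sum_univ_three, h.lie_15 q hqU, h.lie_1b q hqU, h.lie_14 q hqU, lieBracket_self,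
      hθ₁, mul_comm]
  refine ⟨hθ.differentiableAt_coeff hq hdiff 1, h₁, ?_, ?_, ?_, ?_⟩
  · conv_lhs => rw [h.a_eq_smul_e₁ hVU hθ hq ha]
    rw [map_smul, h₁, smul_eq_mul]
    ring
  all_goals
    rw [hθ.fderiv_coeff hq hdiff]
    simp [Fin.sum_univ_three, h.lie_b5 q hqU, h.lie_b4 q hqU, h.lie_b1 hqU, h.lie_45 q hqU,
      h.lie_41 hqU, h.lie_4b hqU, h.lie_54 hqU, h.lie_51 hqU, h.lie_5b hqU, lieBracket_self,
      hθ₁, hθb, mul_comm]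

theorem exists_coordinates_of_transversal_four (h : F.IsRealization U) (hp : p ∈ U)
    (hind : LinearIndependent ℂ ![F.e₄ p, F.e₁ p, F.b p])
    (ha : F.a p ∈ Submodule.span ℂ {F.e₁ p, F.b p}) :
    ∃ (z τ w : C3 → ℂ) (g : ℂ), ∀ᶠ q in 𝓝 p,
      F.HasDerivs z q 0 0 (2 * Complex.I) (z q) (-(Complex.I * z q)) ∧
      F.HasDerivs τ q 0 0 0 1 g ∧
      F.HasDerivs w q (-(2 * g)) (-(2 * g * z q)) 0 (2 * w q) 0 := by
  obtain ⟨r, hr, hrU, θ, hθ⟩ :=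
    exists_isCoframe_of_linearIndependent (h.isOpen.mem_nhds hp) h.diff₄ h.diff₁ h.diffb hind
  have hV : Convex ℝ (Metric.ball p r) := convex_ball p r
  have hpV := Metric.mem_ball_self (x := p) hr
  obtain ⟨τ, hτ⟩ := hθ.exists_primitive hV fun q => h.coeff_lieBracket_transversal_four hrU hθ
  refine ⟨fun q => θ q (F.a q) 1, τ, fun q => θ q (F.e₅ q) 1, θ p (F.e₅ p) 0, ?_⟩
  filter_upwards [Metric.ball_mem_nhds p hr] with q hq
  have ha₀ := h.coeff_a_zero_eq_zero hrU hV.isPreconnected hθ hτ hpV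
    (hθ.coeff_zero_of_mem_span hpV ha) hq
  have h₅₀ := h.coeff_e₅_zero_eq hrU hV.isPreconnected hθ hτ hpV hq
  refine ⟨h.hasDerivs_coeff_a hrU hθ hq ha₀, ⟨(hτ q hq).differentiableAt, ?_, ?_, ?_, ?_, ?_⟩,
    h₅₀ ▸ h.hasDerivs_coeff_e₅ hrU hθ hq ha₀⟩ <;> rw [(hτ q hq).fderiv]
  · exact congrFun (hθ.apply_frame q hq 1) 0
  · exact ha₀
  · exact congrFun (hθ.apply_frame q hq 2) 0
  · exact congrFun (hθ.apply_frame q hq 0) 0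
  · exact h₅₀

end TransversalFour

theorem exists_coordinate_of_transversal_five (h : F.IsRealization U) (hp : p ∈ U)
    (hind : LinearIndependent ℂ ![F.e₅ p, F.e₁ p, F.b p])
    (ha : F.a p ∈ Submodule.span ℂ {F.e₁ p, F.b p})
    (h₄ : F.e₄ p ∈ Submodule.span ℂ {F.e₁ p, F.b p}) :
    ∃ τ : C3 → ℂ, ∀ᶠ q in 𝓝 p, F.HasDerivs τ q 0 0 0 0 1 := by
  obtain ⟨r, hr, hrU, θ, hθ⟩ :=
    exists_isCoframe_of_linearIndependent (h.isOpen.mem_nhds hp) h.diff₅ h.diff₁ h.diffb hind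
  have hV : Convex ℝ (Metric.ball p r) := convex_ball p r
  have hpV := Metric.mem_ball_self (x := p) hr
  have hθ₁ {q} (hq : q ∈ Metric.ball p r) : θ q (F.e₁ q) = Pi.single 1 1 := hθ.apply_frame q hq 1
  have hθb {q} (hq : q ∈ Metric.ball p r) : θ q (F.b q) = Pi.single 2 1 := hθ.apply_frame q hq 2
  have hk : ∀ q ∈ Metric.ball p r, ∀ i j,
      θ q (lieBracket ℂ (![F.e₅, F.e₁, F.b] i) (![F.e₅, F.e₁, F.b] j) q) 0 = 0 := by
    intro q hq i j
    have hqU := hrU hq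
    fin_cases i <;> fin_cases j <;>
      simp [h.lie_51 hqU, h.lie_5b hqU, h.lie_15 q hqU, h.lie_b5 q hqU, h.lie_1b q hqU,
        h.lie_b1 hqU, hθb hq, lieBracket_self]
  obtain ⟨τ, hτ⟩ := hθ.exists_primitive hV hk
  have ha₀ : ∀ q ∈ Metric.ball p r, θ q (F.a q) 0 = 0 := fun q hq => by
    rw [hθ.coeff_eq_mul_exp hV.isPreconnected hk hτ (h.diffa.mono hrU) (ν := -Complex.I)
      (fun q hq i hi => ?_) (fun q hq => ?_) hpV hq, hθ.coeff_zero_of_mem_span hpV ha, zero_mul]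
    · fin_cases i <;> simp_all [h.lie_1a q (hrU hq), h.lie_ba (hrU hq)]
    · simp [h.lie_5a (hrU hq)]
  have h₄₀ : ∀ q ∈ Metric.ball p r, θ q (F.e₄ q) 0 = 0 := fun q hq => by
    rw [hθ.coeff_eq_mul_exp hV.isPreconnected hk hτ (h.diff₄.mono hrU) (ν := 0)
      (fun q hq i hi => ?_) (fun q hq => ?_) hpV hq, hθ.coeff_zero_of_mem_span hpV h₄, zero_mul]
    · fin_cases i <;> simp_all [h.lie_14 q (hrU hq), h.lie_b4 q (hrU hq)]
    · simp [h.lie_54 (hrU hq)]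
  refine ⟨τ, ?_⟩
  filter_upwards [Metric.ball_mem_nhds p hr] with q hq
  have hθ₅ : θ q (F.e₅ q) = Pi.single 0 1 := hθ.apply_frame q hq 0
  refine ⟨(hτ q hq).differentiableAt, ?_, ?_, ?_, ?_, ?_⟩ <;>
    simp [(hτ q hq).fderiv, ha₀ q hq, h₄₀ q hq, hθ₁ hq, hθb hq, hθ₅]

end IsRealization

end FieldTuple

end FieldTuples

section OrbitNormalForms

open VectorField (lieBracket lieBracket_swap lieBracket_const_smul_left
  lieBracket_const_smul_right)
open ComplexConjugate

theorem exists_mem_ker_apply_ne_zero {E : Type*} [AddCommGroup E] [Module ℝ E] (l : E →ₗ[ℝ] ℝ)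
    {σ : E →ₗ[ℝ] ℂ} (hσ : Function.Surjective σ) : ∃ v, l v = 0 ∧ σ v ≠ 0 := by
  by_contra! h
  obtain ⟨u, hu⟩ := hσ 1
  obtain ⟨v, hv⟩ := hσ Complex.I
  have hker := h (l v • u - l u • v) (by simp [mul_comm])
  rw [map_sub, map_smul, map_smul, hu, hv] at hker
  have hlu : l u = 0 := by simpa using congrArg Complex.im hker
  exact one_ne_zero (hu.symm.trans (h u hlu))

namespace FieldTuple

variable {F : FieldTuple} {f g : C3 → ℂ} {U M : Set C3} {Φ : C3 → ℝ} {p q : C3}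

/-- The value at `q` of the real field `x₁ e₁ + x₂ e₂ + x₃ e₃ + x₄ e₄ + x₅ e₅`, where
`c = (x₂ - i x₃) / 2`. -/
def value (F : FieldTuple) (q : C3) (x₁ : ℝ) (c : ℂ) (x₄ x₅ : ℝ) : C3 :=
  (x₁ : ℂ) • F.e₁ q + c • F.a q + conj c • F.b q + (x₄ : ℂ) • F.e₄ q + (x₅ : ℂ) • F.e₅ q

/-- The effect on the five fields of the automorphism `e₁ ↦ -e₁`, `e₃ ↦ -e₃`, `e₅ ↦ -e₅`, which
exchanges `a` and `b`. -/
def swap (F : FieldTuple) : FieldTuple where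
  e₁ := (-1 : ℂ) • F.e₁
  a := F.b
  b := F.a
  e₄ := F.e₄
  e₅ := (-1 : ℂ) • F.e₅

theorem value_swap (F : FieldTuple) (q : C3) (x₁ : ℝ) (c : ℂ) (x₄ x₅ : ℝ) :
    F.swap.value q (-x₁) (conj c) x₄ (-x₅) = F.value q x₁ c x₄ x₅ := by
  simp only [value, swap, Pi.smul_apply, Complex.conj_conj, Complex.ofReal_neg]
  module

theorem IsRealization.swap (h : F.IsRealization U) : F.swap.IsRealization U where
  isOpen := h.isOpen
  diff₁ := h.diff₁.const_smul _
  diffa := h.diffb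
  diffb := h.diffa
  diff₄ := h.diff₄
  diff₅ := h.diff₅.const_smul _
  lie_1a q hq := by
    simp only [FieldTuple.swap, h.lie_1b q hq, smul_zero,
      lieBracket_const_smul_left (h.diff₁.differentiableAt (h.isOpen.mem_nhds hq))]
  lie_1b q hq := by
    simp only [FieldTuple.swap, h.lie_1a q hq, smul_zero,
      lieBracket_const_smul_left (h.diff₁.differentiableAt (h.isOpen.mem_nhds hq))]
  lie_14 q hq := by
    simp only [FieldTuple.swap, h.lie_14 q hq, Pi.smul_apply, smul_comm (2 : ℂ),
      lieBracket_const_smul_left (h.diff₁.differentiableAt (h.isOpen.mem_nhds hq))]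
  lie_15 q hq := by
    have h₁ := h.diff₁.differentiableAt (h.isOpen.mem_nhds hq)
    have h₅ := h.diff₅.differentiableAt (h.isOpen.mem_nhds hq)
    simp only [FieldTuple.swap, lieBracket_const_smul_left h₁, lieBracket_const_smul_right h₅,
      h.lie_15 q hq, smul_zero]
  lie_ab q hq := by
    simp only [FieldTuple.swap, h.lie_ba hq, Pi.smul_apply, smul_smul]
    ring_nf
  lie_a4 := h.lie_b4
  lie_a5 q hq := by
    simp only [FieldTuple.swap, h.lie_b5 q hq, smul_smul, neg_mul_neg, one_mul,
      lieBracket_const_smul_right (h.diff₅.differentiableAt (h.isOpen.mem_nhds hq))]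
  lie_b4 := h.lie_a4
  lie_b5 q hq := by
    simp only [FieldTuple.swap, h.lie_a5 q hq, smul_smul, neg_mul, one_mul,
      lieBracket_const_smul_right (h.diff₅.differentiableAt (h.isOpen.mem_nhds hq))]
  lie_45 q hq := by
    simp only [FieldTuple.swap, h.lie_45 q hq, smul_zero,
      lieBracket_const_smul_right (h.diff₅.differentiableAt (h.isOpen.mem_nhds hq))]

namespace HasDerivs

theorem analyticAt {c₁ ca cb c₄ c₅ : C3 → ℂ}
    (h : ∀ᶠ q in 𝓝 p, F.HasDerivs f q (c₁ q) (ca q) (cb q) (c₄ q) (c₅ q)) : AnalyticAt ℂ f p :=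
  analyticAt_of_eventually_differentiableAt (h.mono fun _ hq => hq.differentiableAt)

variable {c₁ ca cb c₄ c₅ d₁ da db d₄ d₅ : ℂ}

theorem fderiv_value (h : F.HasDerivs f q c₁ ca cb c₄ c₅) (x₁ : ℝ) (c : ℂ) (x₄ x₅ : ℝ) :
    fderiv ℂ f q (F.value q x₁ c x₄ x₅) = x₁ * c₁ + c * ca + conj c * cb + x₄ * c₄ + x₅ * c₅ := by
  simp only [value, map_add, map_smul, smul_eq_mul, h.along_e₁, h.along_a, h.along_b, h.along_e₄,
    h.along_e₅]

theorem add (hf : F.HasDerivs f q c₁ ca cb c₄ c₅) (hg : F.HasDerivs g q d₁ da db d₄ d₅) :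
    F.HasDerivs (fun q => f q + g q) q (c₁ + d₁) (ca + da) (cb + db) (c₄ + d₄) (c₅ + d₅) := by
  refine ⟨hf.differentiableAt.fun_add hg.differentiableAt, ?_, ?_, ?_, ?_, ?_⟩ <;>
    simp only [fderiv_fun_add hf.differentiableAt hg.differentiableAt, add_apply,
      hf.along_e₁, hf.along_a, hf.along_b, hf.along_e₄, hf.along_e₅,
      hg.along_e₁, hg.along_a, hg.along_b, hg.along_e₄, hg.along_e₅]

theorem mul (hf : F.HasDerivs f q c₁ ca cb c₄ c₅) (hg : F.HasDerivs g q d₁ da db d₄ d₅) :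
    F.HasDerivs (fun q => f q * g q) q (f q * d₁ + g q * c₁) (f q * da + g q * ca)
      (f q * db + g q * cb) (f q * d₄ + g q * c₄) (f q * d₅ + g q * c₅) := by
  refine ⟨hf.differentiableAt.fun_mul hg.differentiableAt, ?_, ?_, ?_, ?_, ?_⟩ <;>
    simp only [fderiv_fun_mul hf.differentiableAt hg.differentiableAt, add_apply, smul_apply,
      smul_eq_mul, hf.along_e₁, hf.along_a, hf.along_b, hf.along_e₄, hf.along_e₅,
      hg.along_e₁, hg.along_a, hg.along_b, hg.along_e₄, hg.along_e₅]

theorem comp {φ : ℂ → ℂ} {φ' : ℂ} (hf : F.HasDerivs f q c₁ ca cb c₄ c₅)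
    (hφ : HasDerivAt φ φ' (f q)) :
    F.HasDerivs (fun q => φ (f q)) q (φ' * c₁) (φ' * ca) (φ' * cb) (φ' * c₄) (φ' * c₅) := by
  have hφf : HasFDerivAt (fun q => φ (f q)) (φ' • fderiv ℂ f q) q :=
    hφ.comp_hasFDerivAt q hf.differentiableAt.hasFDerivAt
  refine ⟨hφf.differentiableAt, ?_, ?_, ?_, ?_, ?_⟩ <;>
    simp only [hφf.fderiv, smul_apply, smul_eq_mul, hf.along_e₁, hf.along_a, hf.along_b,
      hf.along_e₄, hf.along_e₅]

theorem const_mul (k : ℂ) (hf : F.HasDerivs f q c₁ ca cb c₄ c₅) :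
    F.HasDerivs (fun q => k * f q) q (k * c₁) (k * ca) (k * cb) (k * c₄) (k * c₅) :=
  hf.comp (by simpa using (hasDerivAt_id (f q)).const_mul k)

end HasDerivs

/-- The real derivative of `x - conj y` for holomorphic functions `x` and `y`. -/
def subConjFDeriv (x y : C3 → ℂ) (q : C3) : C3 →L[ℝ] ℂ :=
  (fderiv ℂ x q).restrictScalars ℝ -
    (Complex.conjCLE : ℂ →L[ℝ] ℂ).comp ((fderiv ℂ y q).restrictScalars ℝ)

theorem subConjFDeriv_apply (x y : C3 → ℂ) (q v : C3) :
    subConjFDeriv x y q v = fderiv ℂ x q v - conj (fderiv ℂ y q v) :=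
  rfl

theorem subConjFDeriv_value {x y : C3 → ℂ} (hx : F.HasDerivs x q 0 1 0 (x q) (Complex.I * x q))
    (hy : F.HasDerivs y q 0 0 1 (y q) (-(Complex.I * y q))) (x₁ : ℝ) (c : ℂ) (x₄ x₅ : ℝ) :
    subConjFDeriv x y q (F.value q x₁ c x₄ x₅) =
      (x₄ + x₅ * Complex.I) * (x q - conj (y q)) := by
  simp only [subConjFDeriv_apply, hx.fderiv_value, hy.fderiv_value, map_add, map_mul, map_neg,
    map_zero, map_one, Complex.conj_conj, Complex.conj_ofReal, Complex.conj_I]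
  ring

theorem hasFDerivAt_sub_conj {x y : C3 → ℂ} (hx : AnalyticAt ℂ x q) (hy : AnalyticAt ℂ y q) :
    HasFDerivAt (fun q => x q - conj (y q)) (subConjFDeriv x y q) q :=
  (hasFDerivAt_restrictScalars hx).sub
    (Complex.conjCLE.hasFDerivAt.comp q (hasFDerivAt_restrictScalars hy))

/-- `Φ` defines the hypersurface `M` near `p`, the tangent vectors of `M` near `p` are values of
real combinations of the fields, and `e₁` does not vanish at `p`. -/
structure IsTangentNear (F : FieldTuple) (M : Set C3) (p : C3) (Φ : C3 → ℝ) : Prop where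
  mem : p ∈ M
  defining : IsDefiningFunctionAt M p Φ
  tangent : ∀ᶠ q in 𝓝 p, q ∈ M → ∀ v, fderiv ℝ Φ q v = 0 → ∃ x₁ c x₄ x₅, v = F.value q x₁ c x₄ x₅
  e₁_ne : F.e₁ p ≠ 0

namespace IsTangentNear

theorem swap (h : F.IsTangentNear M p Φ) : F.swap.IsTangentNear M p Φ where
  mem := h.mem
  defining := h.defining
  tangent := by
    filter_upwards [h.tangent] with q hq hM v hv
    obtain ⟨x₁, c, x₄, x₅, rfl⟩ := hq hM v hv
    exact ⟨_, _, _, _, (F.value_swap q x₁ c x₄ x₅).symm⟩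
  e₁_ne := by simpa [FieldTuple.swap] using h.e₁_ne

theorem exists_apply_value_ne_zero (h : F.IsTangentNear M p Φ) {σ : C3 →ₗ[ℝ] ℂ}
    (hσ : Function.Surjective σ) : ∃ x₁ c x₄ x₅, σ (F.value p x₁ c x₄ x₅) ≠ 0 := by
  obtain ⟨v, hv, hσv⟩ := exists_mem_ker_apply_ne_zero (fderiv ℝ Φ p : C3 →ₗ[ℝ] ℝ) hσ
  obtain ⟨x₁, c, x₄, x₅, rfl⟩ := h.tangent.self_of_nhds h.mem v hv
  exact ⟨x₁, c, x₄, x₅, hσv⟩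

theorem eventually_mem_iff (h : F.IsTangentNear M p Φ) :
    ∀ᶠ q in 𝓝 p, q ∈ M ↔ Φ q = Φ p := by
  rw [(h.defining.mem_iff.self_of_nhds).1 h.mem]
  exact h.defining.mem_iff

theorem tangent_of_eq (h : F.IsTangentNear M p Φ) :
    ∀ᶠ q in 𝓝 p, Φ q = Φ p → ∀ v, fderiv ℝ Φ q v = 0 →
      ∃ x₁ c x₄ x₅, v = F.value q x₁ c x₄ x₅ := by
  filter_upwards [h.tangent, h.eventually_mem_iff] with q hq hM hΦ using hq (hM.2 hΦ)

theorem eventually_mem_iff_eq (h : F.IsTangentNear M p Φ) {I : C3 → ℝ}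
    (hI : ContDiffAt ℝ 1 I p) (hI₀ : fderiv ℝ I p ≠ 0)
    (hvalue : ∀ᶠ q in 𝓝 p, ∀ x₁ c x₄ x₅, fderiv ℝ I q (F.value q x₁ c x₄ x₅) = 0) :
    ∀ᶠ q in 𝓝 p, q ∈ M ↔ I q = I p := by
  have hlevel := eventually_eq_iff_of_fderiv_eq_zero h.defining.analyticAt.contDiffAt hI
    h.defining.fderiv_ne_zero hI₀ (by
      filter_upwards [h.tangent_of_eq, hvalue] with q hq hvalue hΦ v hv
      obtain ⟨x₁, c, x₄, x₅, rfl⟩ := hq hΦ v hv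
      exact hvalue x₁ c x₄ x₅)
  filter_upwards [h.eventually_mem_iff, hlevel] with q hM hq using hM.trans hq

theorem exists_mem_iff_eq_mul (h : F.IsTangentNear M p Φ) {r s : C3 → ℝ}
    (hr : ContDiffAt ℝ 1 r p) (hs : ContDiffAt ℝ 1 s p) (hs₀ : s p ≠ 0)
    (hr₁ : fderiv ℝ r p (Complex.I • F.e₁ p) ≠ 0) (hs₁ : fderiv ℝ s p (Complex.I • F.e₁ p) = 0)
    (hr₄ : ∀ᶠ q in 𝓝 p, ∀ x₁ c x₄ x₅, fderiv ℝ r q (F.value q x₁ c x₄ x₅) = 2 * x₄ * r q)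
    (hs₄ : ∀ᶠ q in 𝓝 p, ∀ x₁ c x₄ x₅, fderiv ℝ s q (F.value q x₁ c x₄ x₅) = 2 * x₄ * s q) :
    ∃ k : ℝ, ∀ᶠ q in 𝓝 p, q ∈ M ↔ r q = k * s q := by
  obtain ⟨k, hk⟩ := exists_eventually_eq_iff_eq_mul h.defining.analyticAt.contDiffAt hr hs
    h.defining.fderiv_ne_zero hs₀ hr₁ hs₁ (by
      filter_upwards [h.tangent_of_eq, hr₄, hs₄] with q hq hr₄ hs₄ hΦ v hv
      obtain ⟨x₁, c, x₄, x₅, rfl⟩ := hq hΦ v hv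
      exact ⟨2 * x₄, hr₄ x₁ c x₄ x₅, hs₄ x₁ c x₄ x₅⟩)
  exact ⟨k, by filter_upwards [h.eventually_mem_iff, hk] with q hM hq using hM.trans hq⟩

-- Such an orbit would be a level set of `Im τ`, which is Levi flat.
theorem false_of_real_derivs (h : F.IsTangentNear M p Φ) (hLevi : IsLeviNondegenerate M)
    {τ : C3 → ℂ} {c₄ c₅ : ℝ} (hτ : ∀ᶠ q in 𝓝 p, F.HasDerivs τ q 0 0 0 c₄ c₅)
    (hne : c₄ ≠ 0 ∨ c₅ ≠ 0) : False := by
  have hτa : AnalyticAt ℂ τ p := HasDerivs.analyticAt hτ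
  have hτp := hτ.self_of_nhds
  obtain ⟨v, hv⟩ : ∃ v, ∃ c : ℝ, c ≠ 0 ∧ fderiv ℂ τ p v = c := by
    rcases hne with hc | hc
    exacts [⟨_, _, hc, hτp.along_e₄⟩, ⟨_, _, hc, hτp.along_e₅⟩]
  obtain ⟨c, hc, hv⟩ := hv
  have hM : ∀ᶠ q in 𝓝 p, q ∈ M ↔ (τ q).im = (τ p).im := by
    refine h.eventually_mem_iff_eq (analyticAt_im hτa).contDiffAt (fun hzero => ?_) ?_
    · have : fderiv ℝ (fun q => (τ q).im) p (Complex.I • v) = c := by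
        simp [fderiv_im_apply hτa, hv]
      exact hc (this.symm.trans (by simp [hzero]))
    · filter_upwards [hτ, hτa.eventually_analyticAt] with q hq hqa x₁ c x₄ x₅
      simp [fderiv_im_apply hqa, hq.fderiv_value]
  have hfderiv : fderiv ℂ (fun q => τ q - τ p) p = fderiv ℂ τ p := fderiv_sub_const _
  refine h.e₁_ne (eq_zero_of_stationary (ι := Fin 0) (v := v)
    (W := fun q => τ q - τ p) (Z := ![]) (κ := ![]) hLevi h.mem (hτa.fun_sub analyticAt_const)
    (fun i => i.elim0) ?_ ?_ (fun i => i.elim0) ?_ fun i => i.elim0)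
  · simpa [sub_eq_zero] using hM
  · rw [hfderiv, hv]
    exact_mod_cast hc
  · rw [hfderiv, hτp.along_e₁]

theorem sub_conj_ne_zero_of_free (h : F.IsTangentNear M p Φ) {x y : C3 → ℂ}
    (hx : F.HasDerivs x p 0 1 0 (x p) (Complex.I * x p))
    (hy : F.HasDerivs y p 0 0 1 (y p) (-(Complex.I * y p))) : x p - conj (y p) ≠ 0 := by
  intro hzero
  let σ : C3 →ₗ[ℝ] ℂ := subConjFDeriv x y p
  have hσ : Function.Surjective σ := fun c =>
    ⟨c • F.a p, by simp [σ, subConjFDeriv_apply, hx.along_a, hy.along_a]⟩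
  obtain ⟨x₁, c, x₄, x₅, hne⟩ := h.exists_apply_value_ne_zero hσ
  exact hne (by simp [σ, subConjFDeriv_value hx hy, hzero])

theorem exists_mem_iff_of_free (h : F.IsTangentNear M p Φ) {x y u : C3 → ℂ}
    (hx : ∀ᶠ q in 𝓝 p, F.HasDerivs x q 0 1 0 (x q) (Complex.I * x q))
    (hy : ∀ᶠ q in 𝓝 p, F.HasDerivs y q 0 0 1 (y q) (-(Complex.I * y q)))
    (hu : ∀ᶠ q in 𝓝 p, F.HasDerivs u q 2 (2 * Complex.I * y q) (-(2 * Complex.I * x q))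
      (2 * u q) 0) :
    ∃ k : ℝ, ∀ᶠ q in 𝓝 p,
      q ∈ M ↔ (u q).im + ‖x q‖ ^ 2 - ‖y q‖ ^ 2 = k * ‖x q - conj (y q)‖ ^ 2 := by
  have hxa := HasDerivs.analyticAt hx
  have hya := HasDerivs.analyticAt hy
  have hua := HasDerivs.analyticAt hu
  have hr (q v) (hx : AnalyticAt ℂ x q) (hy : AnalyticAt ℂ y q) (hu : AnalyticAt ℂ u q) :
      fderiv ℝ (fun q => (u q).im + ‖x q‖ ^ 2 - ‖y q‖ ^ 2) q v = (fderiv ℂ u q v).im +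
        2 * inner ℝ (x q) (fderiv ℂ x q v) - 2 * inner ℝ (y q) (fderiv ℂ y q v) := by
    have hu' := (analyticAt_im hu).differentiableAt
    have hx' := (analyticAt_norm_sq hx).differentiableAt
    rw [fderiv_fun_sub (hu'.fun_add hx') (analyticAt_norm_sq hy).differentiableAt,
      fderiv_fun_add hu' hx', sub_apply, add_apply, fderiv_im_apply hu,
      fderiv_norm_sq_comp_apply hx, fderiv_norm_sq_comp_apply hy]
  refine h.exists_mem_iff_eq_mul
    (((analyticAt_im hua).fun_add (analyticAt_norm_sq hxa)).fun_sub
      (analyticAt_norm_sq hya)).contDiffAt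
    (((hxa.restrictScalars (𝕜 := ℝ)).fun_sub
      ((Complex.conjCLE.analyticAt _).comp (hya.restrictScalars (𝕜 := ℝ)))).contDiffAt.norm_sq ℝ)
    ?_ ?_ ?_ ?_ ?_
  · simpa using h.sub_conj_ne_zero_of_free hx.self_of_nhds hy.self_of_nhds
  · simp [hr, hxa, hya, hua, hx.self_of_nhds.along_e₁, hy.self_of_nhds.along_e₁,
      hu.self_of_nhds.along_e₁]
  · simp [fderiv_norm_sq_apply_of_hasFDerivAt (hasFDerivAt_sub_conj hxa hya), subConjFDeriv_apply,
      hx.self_of_nhds.along_e₁, hy.self_of_nhds.along_e₁]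
  · filter_upwards [hx, hy, hu, hxa.eventually_analyticAt, hya.eventually_analyticAt,
      hua.eventually_analyticAt] with q hx hy hu hxa hya hua x₁ c x₄ x₅
    rw [hr q _ hxa hya hua, hx.fderiv_value, hy.fderiv_value, hu.fderiv_value]
    simp [Complex.inner, Complex.sq_norm, Complex.normSq_apply]
    ring
  · filter_upwards [hx, hy, hxa.eventually_analyticAt, hya.eventually_analyticAt]
      with q hx hy hxa hya x₁ c x₄ x₅
    rw [fderiv_norm_sq_apply_of_hasFDerivAt (hasFDerivAt_sub_conj hxa hya),
      subConjFDeriv_value hx hy]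
    simp [Complex.inner, Complex.sq_norm, Complex.normSq_apply]
    ring

theorem isBiholomorphicNear_of_free (h : F.IsTangentNear M p Φ) (hF : F.IsRealization U)
    (hpU : p ∈ U) (hLevi : IsLeviNondegenerate M)
    (hind : LinearIndependent ℂ ![F.a p, F.e₁ p, F.b p]) :
    IsBiholomorphicNear M (quadric 1) p ∨ IsBiholomorphicNear M (quadric (-1)) p := by
  obtain ⟨x, y, u, hxyu⟩ := hF.exists_coordinates_of_free hpU hind
  have hx := hxyu.mono fun q hq => hq.1
  have hy := hxyu.mono fun q hq => hq.2.1
  have hu := hxyu.mono fun q hq => hq.2.2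
  obtain ⟨k, hM⟩ := h.exists_mem_iff_of_free hx hy hu
  let w : C3 → ℂ := fun q => u q + 2 * k * Complex.I * (x q * y q)
  have hw := hxyu.mono fun q hq => hq.2.2.add ((hq.1.mul hq.2.1).const_mul (2 * k * Complex.I))
  refine isBiholomorphicNear_of_coordinates (κ₀ := k - 1) (κ₁ := k + 1) (w := w) hLevi h.mem
    (HasDerivs.analyticAt hx) (HasDerivs.analyticAt hy) (HasDerivs.analyticAt hw)
    ![F.a p, F.b p, F.e₁ p] ?_ ?_
  · simp [Matrix.det_fin_three, hx.self_of_nhds.along_a, hx.self_of_nhds.along_b,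
      hx.self_of_nhds.along_e₁, hy.self_of_nhds.along_a, hy.self_of_nhds.along_b,
      hy.self_of_nhds.along_e₁, hw.self_of_nhds.along_e₁, w]
  · filter_upwards [hM] with q hq
    have him : (w q).im = (u q).im + 2 * k * (x q * y q).re := by simp [w]
    have hnorm : ‖x q - conj (y q)‖ ^ 2 = ‖x q‖ ^ 2 + ‖y q‖ ^ 2 - 2 * (x q * y q).re := by
      simp only [Complex.sq_norm, Complex.normSq_apply, Complex.sub_re, Complex.conj_re,
        Complex.sub_im, Complex.conj_im, Complex.mul_re]
      ring
    rw [hq, him, hnorm]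
    constructor <;> intro hq <;> linarith

end IsTangentNear

end FieldTuple

end OrbitNormalForms

section TransversalOrbits

theorem linearIndependent_cons_pair_of_notMem_span {K V : Type*} [DivisionRing K] [AddCommGroup V]
    [Module K V] {x u v : V} (h : LinearIndependent K ![u, v])
    (hx : x ∉ Submodule.span K {u, v}) : LinearIndependent K ![x, u, v] :=
  linearIndependent_finCons.2 ⟨h, by simpa [Matrix.range_cons, Set.union_singleton,
    Set.pair_comm] using hx⟩

theorem span_pair_ne_top (u v : C3) : Submodule.span ℂ {u, v} ≠ ⊤ := by
  intro htop
  have hrank := finrank_span_finset_le_card (R := ℂ) ({u, v} : Finset C3)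
  rw [Finset.coe_pair, Set.finrank, htop, finrank_top, Module.finrank_fin_fun] at hrank
  exact absurd (hrank.trans Finset.card_le_two) (by norm_num)

namespace FieldTuple

variable {F : FieldTuple} {U M : Set C3} {Φ : C3 → ℝ} {p : C3}

theorem IsRealization.linearIndependent_e₁_b_or_e₁_a (h : F.IsRealization U) (hp : p ∈ U)
    (he₁ : F.e₁ p ≠ 0) :
    LinearIndependent ℂ ![F.e₁ p, F.b p] ∨ LinearIndependent ℂ ![F.e₁ p, F.a p] := by
  by_contra! hdep
  obtain ⟨⟨n, hn⟩, m, hm⟩ : (∃ n : ℂ, n • F.e₁ p = F.b p) ∧ ∃ m : ℂ, m • F.e₁ p = F.a p := by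
    simpa only [LinearIndependent.pair_iff' he₁, not_forall, not_not] using hdep
  have h1a := h.lie_1a p hp
  have h1b := h.lie_1b p hp
  have hab := h.lie_ab p hp
  simp only [VectorField.lieBracket, ← hn, ← hm, map_smul, sub_eq_zero] at h1a h1b hab
  rw [h1a, h1b, smul_smul, smul_smul, mul_comm, sub_self] at hab
  simpa using (smul_eq_zero.1 hab.symm).resolve_right he₁

namespace IsTangentNear

theorem exists_mem_iff_of_transversal (h : F.IsTangentNear M p Φ) {z ζ w : C3 → ℂ} {μ ν : ℂ}
    (hμ : μ.re = 1) (hν : ν.re = 0)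
    (hz : ∀ᶠ q in 𝓝 p, F.HasDerivs z q 0 0 (2 * Complex.I) (z q) (-(Complex.I * z q)))
    (hζ : ∀ᶠ q in 𝓝 p, F.HasDerivs ζ q 0 0 0 (μ * ζ q) (ν * ζ q))
    (hw : ∀ᶠ q in 𝓝 p, F.HasDerivs w q 1 (z q) 0 (2 * w q) 0) (hζ₀ : ζ p ≠ 0) :
    ∃ k : ℝ, ∀ᶠ q in 𝓝 p, q ∈ M ↔ (w q).im - 4⁻¹ * ‖z q‖ ^ 2 = k * ‖ζ q‖ ^ 2 := by
  have hza := HasDerivs.analyticAt hz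
  have hζa := HasDerivs.analyticAt hζ
  have hwa := HasDerivs.analyticAt hw
  have hr (q v) (hz : AnalyticAt ℂ z q) (hw : AnalyticAt ℂ w q) :
      fderiv ℝ (fun q => (w q).im - 4⁻¹ * ‖z q‖ ^ 2) q v =
        (fderiv ℂ w q v).im - 4⁻¹ * (2 * inner ℝ (z q) (fderiv ℂ z q v)) := by
    have hz' := (analyticAt_norm_sq hz).differentiableAt
    rw [fderiv_fun_sub (analyticAt_im hw).differentiableAt (hz'.const_mul _),
      fderiv_const_mul hz', sub_apply, smul_apply, smul_eq_mul, fderiv_im_apply hw,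
      fderiv_norm_sq_comp_apply hz]
  refine h.exists_mem_iff_eq_mul ((analyticAt_im hwa).fun_sub
    (analyticAt_const.fun_mul (analyticAt_norm_sq hza))).contDiffAt
    (analyticAt_norm_sq hζa).contDiffAt (by simpa using hζ₀) ?_ ?_ ?_ ?_
  · simp [hr, hza, hwa, hz.self_of_nhds.along_e₁, hw.self_of_nhds.along_e₁]
  · simp [fderiv_norm_sq_comp_apply hζa, hζ.self_of_nhds.along_e₁]
  · filter_upwards [hz, hw, hza.eventually_analyticAt, hwa.eventually_analyticAt]
      with q hz hw hza hwa x₁ c x₄ x₅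
    rw [hr q _ hza hwa, hz.fderiv_value, hw.fderiv_value]
    simp [Complex.inner, Complex.sq_norm, Complex.normSq_apply]
    ring
  · filter_upwards [hζ, hζa.eventually_analyticAt] with q hζ hζa x₁ c x₄ x₅
    rw [fderiv_norm_sq_comp_apply hζa, hζ.fderiv_value]
    simp [Complex.inner, Complex.sq_norm, Complex.normSq_apply, hμ, hν]
    ring

theorem isBiholomorphicNear_of_transversal_coordinates (h : F.IsTangentNear M p Φ)
    (hLevi : IsLeviNondegenerate M) {z ζ w : C3 → ℂ} {μ ν : ℂ} (hμ : μ.re = 1) (hν : ν.re = 0)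
    (hz : ∀ᶠ q in 𝓝 p, F.HasDerivs z q 0 0 (2 * Complex.I) (z q) (-(Complex.I * z q)))
    (hζ : ∀ᶠ q in 𝓝 p, F.HasDerivs ζ q 0 0 0 (μ * ζ q) (ν * ζ q))
    (hw : ∀ᶠ q in 𝓝 p, F.HasDerivs w q 1 (z q) 0 (2 * w q) 0) (hζ₀ : ζ p ≠ 0) :
    IsBiholomorphicNear M (quadric 1) p ∨ IsBiholomorphicNear M (quadric (-1)) p := by
  obtain ⟨k, hM⟩ := h.exists_mem_iff_of_transversal hμ hν hz hζ hw hζ₀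
  have hμ₀ : μ ≠ 0 := by
    rintro rfl
    simp at hμ
  refine isBiholomorphicNear_of_coordinates (κ₀ := 4⁻¹) (κ₁ := k) hLevi h.mem
    (HasDerivs.analyticAt hz) (HasDerivs.analyticAt hζ) (HasDerivs.analyticAt hw)
    ![F.b p, F.e₄ p, F.e₁ p] ?_ ?_
  · simp [Matrix.det_fin_three, hz.self_of_nhds.along_b, hz.self_of_nhds.along_e₄,
      hz.self_of_nhds.along_e₁, hζ.self_of_nhds.along_b, hζ.self_of_nhds.along_e₄,
      hζ.self_of_nhds.along_e₁, hw.self_of_nhds.along_b, hw.self_of_nhds.along_e₁, hμ₀, hζ₀]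
  · filter_upwards [hM] with q hq
    rw [hq, sub_eq_iff_eq_add']

theorem isBiholomorphicNear_of_transversal_four (h : F.IsTangentNear M p Φ)
    (hF : F.IsRealization U) (hpU : p ∈ U) (hLevi : IsLeviNondegenerate M)
    (hind : LinearIndependent ℂ ![F.e₄ p, F.e₁ p, F.b p])
    (ha : F.a p ∈ Submodule.span ℂ {F.e₁ p, F.b p}) :
    IsBiholomorphicNear M (quadric 1) p ∨ IsBiholomorphicNear M (quadric (-1)) p := by
  obtain ⟨z, τ, w, g, hzτw⟩ := hF.exists_coordinates_of_transversal_four hpU hind ha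
  have hτ := hzτw.mono fun q hq => hq.2.1
  by_cases hg : g.im = 0
  · have hreal : g = (g.re : ℂ) := Complex.ext rfl (by simp [hg])
    refine (h.false_of_real_derivs hLevi (τ := τ) (c₄ := 1) (c₅ := g.re) ?_ (.inl one_ne_zero)).elim
    rwa [← hreal, Complex.ofReal_one]
  have hg₀ : g ≠ 0 := by
    rintro rfl
    exact hg rfl
  -- The imaginary part of `m` makes `exp (m * τ)` of constant modulus along `e₅`.
  let m : ℂ := ⟨1, g.re / g.im⟩
  refine h.isBiholomorphicNear_of_transversal_coordinates hLevi (μ := m) (ν := m * g)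
    (ζ := fun q => Complex.exp (m * τ q)) (w := fun q => (-(2 * g))⁻¹ * w q) rfl ?_
    (hzτw.mono fun q hq => hq.1) ?_ ?_ (Complex.exp_ne_zero _)
  · simp only [m, Complex.mul_re]
    field_simp
    ring
  · filter_upwards [hτ] with q hq
    convert (hq.const_mul m).comp (Complex.hasDerivAt_exp _) using 1 <;> ring
  · filter_upwards [hzτw] with q hq
    convert hq.2.2.const_mul (-(2 * g))⁻¹ using 1 <;> field_simp <;> simp

theorem eq_top_of_mem (h : F.IsTangentNear M p Φ) {P : Submodule ℂ C3} (h₁ : F.e₁ p ∈ P)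
    (ha : F.a p ∈ P) (hb : F.b p ∈ P) (h₄ : F.e₄ p ∈ P) (h₅ : F.e₅ p ∈ P) : P = ⊤ := by
  by_contra hP
  obtain ⟨l, hl₀, hl⟩ := Submodule.exists_le_ker_of_lt_top P (lt_top_iff_ne_top.2 hP)
  obtain ⟨x₁, c, x₄, x₅, hne⟩ := h.exists_apply_value_ne_zero
    (σ := l.restrictScalars ℝ) (LinearMap.surjective hl₀)
  refine hne (hl ?_)
  exact P.add_mem (P.add_mem (P.add_mem (P.add_mem (P.smul_mem _ h₁) (P.smul_mem _ ha))
    (P.smul_mem _ hb)) (P.smul_mem _ h₄)) (P.smul_mem _ h₅)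

theorem isBiholomorphicNear_of_linearIndependent (h : F.IsTangentNear M p Φ)
    (hF : F.IsRealization U) (hpU : p ∈ U) (hLevi : IsLeviNondegenerate M)
    (hind : LinearIndependent ℂ ![F.e₁ p, F.b p]) :
    IsBiholomorphicNear M (quadric 1) p ∨ IsBiholomorphicNear M (quadric (-1)) p := by
  by_cases ha : F.a p ∈ Submodule.span ℂ {F.e₁ p, F.b p}
  swap
  · exact h.isBiholomorphicNear_of_free hF hpU hLevi
      (linearIndependent_cons_pair_of_notMem_span hind ha)
  by_cases h₄ : F.e₄ p ∈ Submodule.span ℂ {F.e₁ p, F.b p}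
  swap
  · exact h.isBiholomorphicNear_of_transversal_four hF hpU hLevi
      (linearIndependent_cons_pair_of_notMem_span hind h₄) ha
  by_cases h₅ : F.e₅ p ∈ Submodule.span ℂ {F.e₁ p, F.b p}
  · exact absurd (h.eq_top_of_mem (Submodule.mem_span_of_mem (by simp)) ha
      (Submodule.mem_span_of_mem (by simp)) h₄ h₅) (span_pair_ne_top _ _)
  · obtain ⟨τ, hτ⟩ := hF.exists_coordinate_of_transversal_five hpU
      (linearIndependent_cons_pair_of_notMem_span hind h₅) ha h₄
    exact (h.false_of_real_derivs hLevi (c₄ := 0) (c₅ := 1) (by simpa using hτ)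
      (.inr one_ne_zero)).elim

theorem isBiholomorphicNear (h : F.IsTangentNear M p Φ) (hF : F.IsRealization U) (hpU : p ∈ U)
    (hLevi : IsLeviNondegenerate M) :
    IsBiholomorphicNear M (quadric 1) p ∨ IsBiholomorphicNear M (quadric (-1)) p := by
  rcases hF.linearIndependent_e₁_b_or_e₁_a hpU h.e₁_ne with hind | hind
  · exact h.isBiholomorphicNear_of_linearIndependent hF hpU hLevi hind
  · refine h.swap.isBiholomorphicNear_of_linearIndependent hF.swap hpU hLevi ?_
    simpa [FieldTuple.swap, LinearIndependent.pair_iff'] using hind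

end IsTangentNear

end FieldTuple

end TransversalOrbits

section Realization

namespace G537

/-- The basis vectors `e₁, …, e₅`, indexed from `0`. -/
def basisVec (i : Fin 5) : G537 :=
  (Pi.single i 1 : Fin 5 → ℝ)

theorem basisVec_apply (i j : Fin 5) : basisVec i j = if j = i then 1 else 0 := by
  simp [basisVec, Pi.single_apply]

theorem neg_apply (x : G537) (i : Fin 5) : (-x) i = -x i := rfl

theorem sub_apply (x y : G537) (i : Fin 5) : (x - y) i = x i - y i := rfl

theorem eq_sum_basisVec (x : G537) : x = x 0 • basisVec 0 + x 1 • basisVec 1 + x 2 • basisVec 2 +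
    x 3 • basisVec 3 + x 4 • basisVec 4 := by
  apply ext_coords <;> simp [add_apply, smul_apply, basisVec_apply]

variable (ρ : G537 →ₗ[ℝ] (C3 → C3))

/-- The vector field by which `x + i y`, in the complexification of `𝔤_{5,37}`, acts. -/
def complexField (x y : G537) : C3 → C3 :=
  ρ x + Complex.I • ρ y

theorem smul_complexField_apply (c : ℂ) (x y : G537) (q : C3) :
    c • complexField ρ x y q =
      complexField ρ (c.re • x - c.im • y) (c.im • x + c.re • y) q := by
  ext i
  nth_rw 1 [← Complex.re_add_im c]
  simp only [complexField, map_add, map_sub, map_smul, Pi.add_apply, Pi.sub_apply, Pi.smul_apply,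
    smul_eq_mul, Complex.real_smul]
  linear_combination (c.im * ρ y q i) * Complex.I_mul_I

/-- The fields by which `e₁`, `e₂ + i e₃`, `e₂ - i e₃`, `e₄`, `e₅` act. -/
def fields : FieldTuple where
  e₁ := complexField ρ (basisVec 0) 0
  a := complexField ρ (basisVec 1) (basisVec 2)
  b := complexField ρ (basisVec 1) (-basisVec 2)
  e₄ := complexField ρ (basisVec 3) 0
  e₅ := complexField ρ (basisVec 4) 0

theorem fields_value (x : G537) (q : C3) :
    (fields ρ).value q (x 0) ((x 1 - Complex.I * x 2) / 2) (x 3) (x 4) = ρ x q := by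
  conv_rhs => rw [eq_sum_basisVec x]
  ext i
  simp only [FieldTuple.value, fields, complexField, map_add, map_sub, map_neg, map_smul, map_mul,
    map_zero, map_div₀, map_ofNat, Complex.conj_I, Complex.conj_ofReal, Pi.add_apply, Pi.neg_apply,
    Pi.smul_apply, Pi.zero_apply, smul_eq_mul, Complex.real_smul]
  linear_combination (-x 2 * ρ (basisVec 2) q i) * Complex.I_mul_I

end G537

namespace IsHolomorphicRealization

open G537

variable {U : Set C3} {ρ : G537 →ₗ[ℝ] (C3 → C3)}

theorem differentiableOn_complexField (h : IsHolomorphicRealization U ρ) (x y : G537) :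
    DifferentiableOn ℂ (complexField ρ x y) U :=
  (h.holomorphic x).add ((h.holomorphic y).const_smul _)

theorem lieBracket_complexField (h : IsHolomorphicRealization U ρ) (x y x' y' : G537) {q : C3}
    (hq : q ∈ U) :
    VectorField.lieBracket ℂ (complexField ρ x y) (complexField ρ x' y') q =
      complexField ρ (⁅x, x'⁆ - ⁅y, y'⁆) (⁅x, y'⁆ + ⁅y, x'⁆) q := by
  have hd (x : G537) : DifferentiableAt ℂ (ρ x) q :=
    (h.holomorphic x).differentiableAt (h.isOpen.mem_nhds hq)
  have hsmul (x : G537) : DifferentiableAt ℂ (Complex.I • ρ x) q := (hd x).const_smul _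
  rw [complexField, complexField, VectorField.lieBracket_add_left (hd x) (hsmul y),
    VectorField.lieBracket_add_right (hd x') (hsmul y'),
    VectorField.lieBracket_add_right (hd x') (hsmul y'),
    VectorField.lieBracket_const_smul_left (hd y), VectorField.lieBracket_const_smul_left (hd y),
    VectorField.lieBracket_const_smul_right (hd y'),
    VectorField.lieBracket_const_smul_right (hd y')]
  simp only [← h.map_lie _ _ q hq, complexField, map_add, map_sub, Pi.add_apply, Pi.sub_apply,
    Pi.smul_apply, smul_add, smul_smul, Complex.I_mul_I]
  module

theorem lieBracket_complexField_eq_smul (h : IsHolomorphicRealization U ρ)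
    {x y x' y' x'' y'' : G537} {c : ℂ} (hre : ⁅x, x'⁆ - ⁅y, y'⁆ = c.re • x'' - c.im • y'')
    (him : ⁅x, y'⁆ + ⁅y, x'⁆ = c.im • x'' + c.re • y'') {q : C3} (hq : q ∈ U) :
    VectorField.lieBracket ℂ (complexField ρ x y) (complexField ρ x' y') q =
      c • complexField ρ x'' y'' q := by
  rw [h.lieBracket_complexField x y x' y' hq, smul_complexField_apply, hre, him]

theorem lieBracket_complexField_eq_zero (h : IsHolomorphicRealization U ρ) {x y x' y' : G537}
    (hre : ⁅x, x'⁆ - ⁅y, y'⁆ = 0) (him : ⁅x, y'⁆ + ⁅y, x'⁆ = 0) {q : C3} (hq : q ∈ U) :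
    VectorField.lieBracket ℂ (complexField ρ x y) (complexField ρ x' y') q = 0 := by
  rw [h.lieBracket_complexField x y x' y' hq, hre, him]
  simp [complexField]

theorem fields (h : IsHolomorphicRealization U ρ) : (G537.fields ρ).IsRealization U := by
  refine
    { isOpen := h.isOpen
      diff₁ := h.differentiableOn_complexField _ _
      diffa := h.differentiableOn_complexField _ _
      diffb := h.differentiableOn_complexField _ _
      diff₄ := h.differentiableOn_complexField _ _
      diff₅ := h.differentiableOn_complexField _ _
      lie_1a := fun q hq => h.lieBracket_complexField_eq_zero ?_ ?_ hq
      lie_1b := fun q hq => h.lieBracket_complexField_eq_zero ?_ ?_ hq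
      lie_14 := fun q hq => h.lieBracket_complexField_eq_smul ?_ ?_ hq
      lie_15 := fun q hq => h.lieBracket_complexField_eq_zero ?_ ?_ hq
      lie_ab := fun q hq => h.lieBracket_complexField_eq_smul ?_ ?_ hq
      lie_a4 := fun q hq => (h.lieBracket_complexField_eq_smul ?_ ?_ hq).trans (one_smul ℂ _)
      lie_a5 := fun q hq => h.lieBracket_complexField_eq_smul ?_ ?_ hq
      lie_b4 := fun q hq => (h.lieBracket_complexField_eq_smul ?_ ?_ hq).trans (one_smul ℂ _)
      lie_b5 := fun q hq => h.lieBracket_complexField_eq_smul ?_ ?_ hq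
      lie_45 := fun q hq => h.lieBracket_complexField_eq_zero ?_ ?_ hq }
  all_goals
    apply ext_coords <;> simp [lie_apply_zero, lie_apply_one, lie_apply_two, lie_apply_three,
      lie_apply_four, smul_apply, add_apply, neg_apply, sub_apply, zero_apply, basisVec_apply] <;>
    norm_num

end IsHolomorphicRealization

theorem IsDefiningFunctionAt.eventually {M : Set C3} {p : C3} {Φ : C3 → ℝ}
    (h : IsDefiningFunctionAt M p Φ) : ∀ᶠ q in 𝓝 p, IsDefiningFunctionAt M q Φ := by
  filter_upwards [h.analyticAt.eventually_analyticAt,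
    h.analyticAt.fderiv.continuousAt.eventually_ne h.fderiv_ne_zero, h.mem_iff.eventually_nhds]
    with q hanalytic hne hmem using ⟨hanalytic, hne, hmem⟩

namespace IsFiveDimensionalOrbit

variable {U M : Set C3} {ρ : G537 →ₗ[ℝ] (C3 → C3)} {p : C3} {Φ : C3 → ℝ}

theorem evalAt_injective (h : IsFiveDimensionalOrbit U ρ M) (hp : p ∈ M)
    (hΦ : IsDefiningFunctionAt M p Φ) : Function.Injective (evalAt ρ p) := by
  have hdim : Module.finrank ℝ G537 = 5 := Module.finrank_fin_fun ℝ
  have : FiniteDimensional ℝ G537 := Module.finite_of_finrank_eq_succ hdim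
  have hdimC3 : Module.finrank ℝ C3 = 6 := by
    simp [Module.finrank_pi_fintype, Complex.finrank_real_complex]
  have hΦ₀ : (fderiv ℝ Φ p : C3 →ₗ[ℝ] ℝ) ≠ 0 := fun hzero =>
    hΦ.fderiv_ne_zero (ContinuousLinearMap.coe_injective hzero)
  have hker := Module.Dual.finrank_ker_add_one_of_ne_zero hΦ₀
  have hrank := LinearMap.finrank_range_add_finrank_ker (evalAt ρ p)
  rw [h.range_eq_tangent p hp Φ hΦ] at hrank
  rw [← LinearMap.ker_eq_bot, ← Submodule.finrank_eq_zero (R := ℝ)]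
  lia

theorem isTangentNear (h : IsFiveDimensionalOrbit U ρ M) (hp : p ∈ M)
    (hΦ : IsDefiningFunctionAt M p Φ) : (G537.fields ρ).IsTangentNear M p Φ where
  mem := hp
  defining := hΦ
  tangent := by
    filter_upwards [hΦ.eventually] with q hΦq hq v hv
    obtain ⟨x, rfl⟩ := (h.range_eq_tangent q hq Φ hΦq).ge hv
    exact ⟨_, _, _, _, (G537.fields_value ρ x q).symm⟩
  e₁_ne hzero := by
    have hbasis : G537.basisVec 0 = 0 := h.evalAt_injective hp hΦ (by
      simpa [G537.fields, G537.complexField, evalAt] using hzero)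
    simpa [G537.basisVec_apply, G537.zero_apply] using congrFun hbasis 0

end IsFiveDimensionalOrbit

end Realization

end

theorem mainTheorem6 (U : Set C3) (ρ : G537 →ₗ[ℝ] (C3 → C3))
    (hρ : IsHolomorphicRealization U ρ) (M : Set C3)
    (hM : IsFiveDimensionalOrbit U ρ M) (hLevi : IsLeviNondegenerate M) :
    IsSpherical M := by
  refine isSpherical_of_isBiholomorphicNear hM.isConnected fun p hp => ?_
  obtain ⟨Φ, hΦ⟩ := hM.hypersurface p hp
  exact (hM.isTangentNear hp hΦ).isBiholomorphicNear hρ.fields (hM.subset hp) hLevi
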